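/- Let $m\ge 1$ be an integer and let $(G_m^t)_{t\ge 1}$ be the Barabási–Albert random graph process: for every $n\in\{0,1,2,\dots\}$, at time $t=n(m+1)+1$ a new vertex $v_{n+1}$ is added (so at time $1$ the graph is the single vertex $v_1$), and for $i=2,\dots,m+1$, at time $t=n(m+1)+i$ an edge from $v_{n+1}$ to a vertex $v\in\{v_1,\dots,v_{n+1}\}$ is added, where, given the past, $v$ is chosen with probability $$\frac{d(v,t-1)}{2(mn+i-1)-1}\ \text{ if } v\ne v_{n+1},\qquad \frac{d(v,t-1)+1}{2(mn+i-1)-1}\ \text{ if } v=v_{n+1},$$ $d(v,t)$ being the degree of $v$ in $G_m^t$ (a loop counts twice). A Yule process $\{N_\lambda^m(T)\}_{T\ge 0}$ with rate $\lambda>0$ and $m$ initial individuals is a Markov counting process with $N_\lambda^m(0)=m$ almost surely such that, with errors $o(h)$ as $h\downarrow 0$ that do not depend on $T$, $P(N(T+h)=k+\ell\mid N(T)=k)$ equals $1-k\lambda h+o(h)$ for $\ell=0$, $k\lambda h+o(h)$ for $\ell=1$, and $o(h)$ for $\ell>1$. Let $z(i,w)\in\{0,1,2,\dots\}$ be defined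 for positive integers $i$ and real $w>0$, such that $c(w):=\lim_{i\to\infty}z(i,w)/i$ exists and is finite for every $w>0$, and $c$ is increasing (not necessarily strictly) in $w$. Let $b\ge 1$ and $0<w_1<\dots<w_b$. Then for all integers $m\le k_1\le\dots\le k_b$, $$\lim_{i\to\infty}P\big[d(v_i,(i+z(i,w_\ell))(m+1))=k_\ell,\ \ell=1,\dots,b\big]=P\big[N_{1/2}^m(\ln(1+c(w_\ell)))=k_\ell,\ \ell=1,\dots,b\big]$$ $$=\prod_{\ell=1}^b\binom{k_\ell-1}{k_\ell-k_{\ell-1}}e^{-\frac{k_{\ell-1}}2\ln\left(\frac{1+c_\ell}{1+c_{\ell-1}}\right)}\Big(1-e^{-\frac12\ln\left(\frac{1+c_\ell}{1+c_{\ell-1}}\right)}\Big)^{k_\ell-k_{\ell-1}},$$ where $k_0=m$, $c_0=0$, $c_\ell=c(w_\ell)$ for $1\le \ell\le b$, and $0^0=1$. The first equality holds for all other $k_1,\dots,k_b\in\{0,1,2,\dots\}$ as well, so the joint law of the degrees converges to that of $\big(N_{1/2}^m(\ln(1+c(w_\ell)))\big)_{\ell=1}^b$. -/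

import Mathlib

open MeasureTheory ProbabilityTheory Filter Topology Asymptotics

/-- A finite directed multigraph, loops allowed, with vertices `v_1, …, v_numVertices`
(the vertex `v_j` is represented by the number `j`); an edge from `v_a` to `v_b` is the pair
`(a, b)`. -/
@[ext] structure BAGraph where
  numVertices : ℕ
  edges : Multiset (ℕ × ℕ)

namespace BAGraph

/-- The random graphs are discrete random variables. -/
instance : MeasurableSpace BAGraph := ⊤

/-- The graph without vertices and edges. -/
def empty : BAGraph := ⟨0, 0⟩

/-- Add one new vertex, without edges. -/
def addVertex (G : BAGraph) : BAGraph := ⟨G.numVertices + 1, G.edges⟩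

/-- Add one edge from `v_a` to `v_b`. -/
def addEdge (G : BAGraph) (a b : ℕ) : BAGraph := ⟨G.numVertices, (a, b) ::ₘ G.edges⟩

/-- The degree of `v_j`: the number of edge ends at `v_j`, so that a loop counts twice. -/
def degree (G : BAGraph) (j : ℕ) : ℕ :=
  (G.edges.map Prod.fst).count j + (G.edges.map Prod.snd).count j

end BAGraph

/-- The probability that the edge added at time `n (m + 1) + i` (where `2 ≤ i ≤ m + 1`), which
starts at `v_{n+1}`, ends at `v_j`, when the graph at the preceding time is `G`. -/
noncomputable def attachProb (m n i : ℕ) (G : BAGraph) (j : ℕ) : ℝ :=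
  if j = n + 1 then ((G.degree j : ℝ) + 1) / (2 * ((m : ℝ) * n + i - 1) - 1)
  else (G.degree j : ℝ) / (2 * ((m : ℝ) * n + i - 1) - 1)

/-- `(G t)_{t ≥ 1}` is the Barabási–Albert random graph process with parameter `m` under `P`
(with the empty graph put in front as `G 0`): at time `n (m + 1) + 1` the vertex `v_{n+1}` is added,
and at each time `n (m + 1) + i`, `i = 2, …, m + 1`, an edge from `v_{n+1}` to some
`v_j`, `1 ≤ j ≤ n + 1`, is added; given the whole past, `v_j` is chosen with
probability `attachProb`. -/
structure IsBAProcess {Ω : Type*} [MeasurableSpace Ω] (m : ℕ) (P : Measure Ω)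
    (G : ℕ → Ω → BAGraph) : Prop where
  measurable : ∀ t, Measurable (G t)
  start : ∀ᵐ ω ∂P, G 0 ω = BAGraph.empty
  vertex_step : ∀ n : ℕ, ∀ᵐ ω ∂P, G (n * (m + 1) + 1) ω = (G (n * (m + 1)) ω).addVertex
  edge_step : ∀ n i : ℕ, 2 ≤ i → i ≤ m + 1 → ∀ g : ℕ → BAGraph,
    P {ω | ∀ s ≤ n * (m + 1) + i - 1, G s ω = g s} ≠ 0 →
    ∀ j : ℕ, 1 ≤ j → j ≤ n + 1 →
      (P[|{ω | ∀ s ≤ n * (m + 1) + i - 1, G s ω = g s}]).real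
          {ω | G (n * (m + 1) + i) ω = (g (n * (m + 1) + i - 1)).addEdge (n + 1) j} =
        attachProb m n i (g (n * (m + 1) + i - 1)) j

/-- The main term of the probability that a Yule process with birth intensity `rate` has `l` births
in a time interval of length `h` that starts with `k` individuals. -/
def yuleMainTerm (rate : ℝ) (k l : ℕ) (h : ℝ) : ℝ :=
  if l = 0 then 1 - k * rate * h else if l = 1 then k * rate * h else 0

/-- `(N T)_{T ≥ 0}` is a Yule process (linear birth process) with birth intensity `rate` and `g`
initial individuals under `P`: a counting process (integer-valued, nondecreasing,
right-continuous paths) with `N 0 = g` almost surely, that is Markov and satisfies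
`P(N(T+h) = k + l | N(T) = k) = yuleMainTerm rate k l h + o(h)`, where the error term does
not depend on `T`. Only the values `N T` with `0 ≤ T` matter. -/
structure IsYuleProcess {Ω : Type*} [MeasurableSpace Ω] (rate : ℝ) (g : ℕ) (P : Measure Ω)
    (N : ℝ → Ω → ℕ) : Prop where
  measurable : ∀ T, 0 ≤ T → Measurable (N T)
  mono : ∀ᵐ ω ∂P, MonotoneOn (fun T => N T ω) (Set.Ici 0)
  right_continuous : ∀ᵐ ω ∂P, ∀ T, 0 ≤ T → ContinuousWithinAt (fun S => N S ω) (Set.Ici T) T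
  initial : ∀ᵐ ω ∂P, N 0 ω = g
  markov : ∀ (n : ℕ) (s : Fin (n + 1) → ℝ) (x : Fin (n + 1) → ℕ) (T : ℝ) (j : ℕ),
    0 ≤ s 0 → StrictMono s → s (Fin.last n) < T →
    P {ω | ∀ a, N (s a) ω = x a} ≠ 0 →
      (P[|{ω | ∀ a, N (s a) ω = x a}]).real {ω | N T ω = j} =
        (P[|{ω | N (s (Fin.last n)) ω = x (Fin.last n)}]).real {ω | N T ω = j}
  infinitesimal : ∀ k l : ℕ, ∃ r : ℝ → ℝ, r =o[𝓝[>] 0] (fun h : ℝ => h) ∧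
    ∀ T h : ℝ, 0 ≤ T → 0 < h → P {ω | N T ω = k} ≠ 0 →
      |(P[|{ω | N T ω = k}]).real {ω | N (T + h) ω = k + l} - yuleMainTerm rate k l h| ≤ r h

/-- The product
`∏_{ℓ=1}^b C(k_ℓ - 1, k_ℓ - k_{ℓ-1}) e^{-(k_{ℓ-1}/2) ln((1+c_ℓ)/(1+c_{ℓ-1}))}`
`(1 - e^{-(1/2) ln((1+c_ℓ)/(1+c_{ℓ-1}))})^{k_ℓ - k_{ℓ-1}}`, where `k_0 = m` and `c_0 = 0`. -/
noncomputable def yuleProduct (m : ℕ) {b : ℕ} (k : Fin b → ℕ) (c : Fin b → ℝ) : ℝ :=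
  let K : Fin (b + 1) → ℕ := Fin.cons m k
  let C : Fin (b + 1) → ℝ := Fin.cons 0 c
  ∏ l : Fin b,
    ((K l.succ - 1).choose (K l.succ - K l.castSucc) : ℝ) *
      Real.exp (-((K l.castSucc : ℝ) / 2) * Real.log ((1 + C l.succ) / (1 + C l.castSucc))) *
      (1 - Real.exp (-(1 / 2) * Real.log ((1 + C l.succ) / (1 + C l.castSucc)))) ^
        (K l.succ - K l.castSucc)

/-! An edge attaches to an old vertex of degree `l` with probability `l * α`, where `α` depends only
on the time. So the degree of `v_i`, after its own block of edges, is exactly a time-inhomogeneous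
linear birth chain, with one-step operator `yuleStep α`. This operator is the Euler step of
Kolmogorov's forward equations for the Yule process, whose solution is `yuleProb`. Each Euler step
has an error of order `α ^ 2`, and on `{0, …, K}` the step is an ℓ¹ contraction once `K * α ≤ 1`, so
the errors only add up: `exists_abs_sub_yuleProb_le` bounds the distance to `yuleProb` at time `∑ α`
by a multiple of `∑ α ^ 2`.

The criterion is used twice. For a Yule process, cutting an interval into `n` equal pieces and
letting `n → ∞` turns the infinitesimal description into exact transition probabilities
(`real_timeCylinder_inter`), and the Markov property then gives the finite-dimensional
distributions. For the graph, the `m` rates of block `n` add up to about `1 / (2 * n)`, so between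
blocks `N` and `M` the elapsed time is about `(1/2) * log (M / N)`, while the sum of squares is at
most `1 / (2 * i)` times the sum and vanishes in the limit. This is the source of both the intensity
`1/2` and the time change `log (1 + c)`.

Three points remain. `v_i` starts with degree `m`, because loops are asymptotically negligible
(`tendsto_real_degree_birth`). Several times are treated by carrying an event of the past through
the estimate instead of conditioning on it (`tendsto_real_forall_degree_of_init`). Finally, the
times `i + z i (w l)` need not be ordered for finite `i`; they are replaced by running maxima, which
have the same limits, and over such short gaps the degree most likely does not change. -/

lemma monotone_finCons {β : Type*} [Preorder β] {b : ℕ} {a : β} {f : Fin b → β}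
    (ha : ∀ l, a ≤ f l) (hf : Monotone f) : Monotone (Fin.cons a f : Fin (b + 1) → β) := by
  intro i j hij
  cases i using Fin.cases with
  | zero => cases j using Fin.cases with
    | zero => exact le_rfl
    | succ j => exact ha j
  | succ i => cases j using Fin.cases with
    | zero => exact absurd hij (by simp)
    | succ j => exact hf (Fin.succ_le_succ_iff.1 hij)

/-! ### The linear birth chain and Kolmogorov's forward equations. -/

/-- One time step of length `α` of the linear birth chain with unit birth intensity, acting on
(sub)probability weights on `ℕ`. -/
def yuleStep (α : ℝ) (u : ℕ → ℝ) (k : ℕ) : ℝ :=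
  (1 - k * α) * u k + ((k - 1 : ℕ) : ℝ) * α * u (k - 1)

/-- The transition probability from `a` to `k` of the Yule process of unit birth intensity in a time
interval of length `t`. -/
noncomputable def yuleProb (a k : ℕ) (t : ℝ) : ℝ :=
  if k < a then 0
  else ((k - 1).choose (k - a) : ℝ) * Real.exp (-(a * t)) * (1 - Real.exp (-t)) ^ (k - a)

lemma yuleStep_sub (α : ℝ) (u v : ℕ → ℝ) (k : ℕ) :
    yuleStep α (fun l => u l - v l) k = yuleStep α u k - yuleStep α v k := by
  simp only [yuleStep]; ring

/-- For `K * α ≤ 1` all coefficients up to state `K` are nonnegative, and each state splits its mass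
between itself and its successor. Mass only moves upwards, so truncating at `K` only loses mass. -/
lemma sum_abs_yuleStep_le {α : ℝ} (hα : 0 ≤ α) (K : ℕ) (hK : K * α ≤ 1) (u : ℕ → ℝ) :
    ∑ k ∈ Finset.range (K + 1), |yuleStep α u k| ≤ ∑ k ∈ Finset.range (K + 1), |u k| := by
  suffices h : ∑ k ∈ Finset.range (K + 1), |yuleStep α u k| ≤
      -- The subtracted term is the mass that leaves through the top state; keeping track of it
      -- closes the induction on `K`.
      ∑ k ∈ Finset.range (K + 1), |u k| - K * α * |u K| by
    have : 0 ≤ K * α * |u K| := by positivity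
    linarith
  induction K with
  | zero => simp [yuleStep]
  | succ K ih =>
    have hK' : (K : ℝ) * α ≤ 1 := by
      push_cast at hK; nlinarith
    have h1 := ih hK'
    rw [Finset.sum_range_succ, Finset.sum_range_succ (fun k => |u k|)]
    have h2 : |yuleStep α u (K + 1)| ≤ (1 - (K + 1 : ℕ) * α) * |u (K + 1)| + K * α * |u K| := by
      unfold yuleStep
      refine (abs_add_le _ _).trans ?_
      rw [abs_mul, abs_mul, abs_of_nonneg (by linarith : (0:ℝ) ≤ 1 - (K + 1 : ℕ) * α)]
      simp only [Nat.add_sub_cancel]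
      rw [abs_of_nonneg (by positivity : (0:ℝ) ≤ K * α)]
    linarith

/-- A discrete Gronwall estimate without growth factor: the step is a contraction, so the local
errors, at most `ε j` in each of the `K + 1` coordinates, simply accumulate. -/
lemma sum_abs_le_of_approx_yuleStep {K J : ℕ} {d : ℕ → ℕ → ℝ} {α ε : ℕ → ℝ}
    (hα : ∀ j < J, 0 ≤ α j) (hK : ∀ j < J, K * α j ≤ 1)
    (hd : ∀ j < J, ∀ k ≤ K, |d (j + 1) k - yuleStep (α j) (d j) k| ≤ ε j) :
    ∑ k ∈ Finset.range (K + 1), |d J k| ≤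
      ∑ k ∈ Finset.range (K + 1), |d 0 k| + (K + 1) * ∑ j ∈ Finset.range J, ε j := by
  induction J with
  | zero => simp
  | succ J ih =>
    have h1 := ih (fun j hj => hα j (by omega)) (fun j hj => hK j (by omega))
      (fun j hj => hd j (by omega))
    have h2 := sum_abs_yuleStep_le (hα J (by omega)) K (hK J (by omega)) (d J)
    have h3 : ∑ k ∈ Finset.range (K + 1), |d (J + 1) k| ≤
        ∑ k ∈ Finset.range (K + 1), (|yuleStep (α J) (d J) k| + ε J) := by
      refine Finset.sum_le_sum fun k hk => ?_
      have := hd J (by omega) k (by simpa [Nat.lt_succ_iff] using hk)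
      have h4 := abs_add_le (d (J + 1) k - yuleStep (α J) (d J) k) (yuleStep (α J) (d J) k)
      rw [sub_add_cancel] at h4
      linarith
    rw [Finset.sum_add_distrib] at h3
    simp only [Finset.sum_const, Finset.card_range, nsmul_eq_mul] at h3
    rw [Finset.sum_range_succ (fun j => ε j)]
    push_cast at h3
    linarith

lemma yuleProb_zero (a k : ℕ) : yuleProb a k 0 = if k = a then 1 else 0 := by
  unfold yuleProb
  rcases lt_trichotomy k a with h | rfl | h
  · simp [h, h.ne]
  · simp
  · simp [h.not_gt, h.ne', Nat.sub_ne_zero_of_lt h]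

lemma abs_yuleProb_le (a k : ℕ) {t : ℝ} (ht : 0 ≤ t) :
    |yuleProb a k t| ≤ ((k - 1).choose (k - a) : ℝ) := by
  unfold yuleProb
  split_ifs with h
  · simp
  · have h1 : Real.exp (-t) ≤ 1 := Real.exp_le_one_iff.2 (by linarith)
    have h2 : Real.exp (-(a * t)) ≤ 1 := Real.exp_le_one_iff.2 (by
      have : 0 ≤ a * t := by positivity
      linarith)
    have h3 := Real.exp_pos (-t)
    have h4 : (1 - Real.exp (-t)) ^ (k - a) ≤ 1 := pow_le_one₀ (by linarith) (by linarith)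
    have h5 : 0 ≤ (1 - Real.exp (-t)) ^ (k - a) := pow_nonneg (by linarith) _
    rw [abs_of_nonneg (by positivity), mul_assoc]
    refine mul_le_of_le_one_right (by positivity) ?_
    exact mul_le_one₀ h2 h5 h4

/-- Kolmogorov's forward equation. It needs no positivity of `a` or `k`: the truncated `k - 1` comes
with coefficient `0` at `k = 0`, and state `0` is absorbing. -/
lemma hasDerivAt_yuleProb (a k : ℕ) (t : ℝ) :
    HasDerivAt (yuleProb a k)
      (-(k * yuleProb a k t) + ((k - 1 : ℕ) : ℝ) * yuleProb a (k - 1) t) t := by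
  have hexp : HasDerivAt (fun t : ℝ => Real.exp (-t)) (-Real.exp (-t)) t := by
    simpa using (hasDerivAt_neg t).exp
  have hexpa : HasDerivAt (fun t : ℝ => Real.exp (-(a * t))) (-a * Real.exp (-(a * t))) t := by
    have h : HasDerivAt (fun t : ℝ => -(a * t)) (-(a : ℝ)) t := by
      simpa using ((hasDerivAt_id t).const_mul (-(a : ℝ)))
    exact h.exp.congr_deriv (mul_comm _ _)
  rcases lt_or_ge k a with h | h
  · have h1 : yuleProb a k = fun _ => 0 := by ext t; simp [yuleProb, h]
    have h2 : yuleProb a (k - 1) t = 0 := by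
      rw [yuleProb, if_pos (by omega)]
    rw [h1, h2]
    simpa using hasDerivAt_const t (0 : ℝ)
  obtain ⟨j, rfl⟩ := Nat.exists_eq_add_of_le h
  have h1 : yuleProb a (a + j) = fun t => ((a + j - 1).choose j : ℝ) * Real.exp (-(a * t)) *
      (1 - Real.exp (-t)) ^ j := by
    ext t; simp [yuleProb]
  have h2 := (hexpa.const_mul ((a + j - 1).choose j : ℝ)).mul ((hexp.const_sub 1).pow j)
  rw [h1]
  refine h2.congr_deriv ?_
  cases j with
  | zero =>
    rcases Nat.eq_zero_or_pos a with rfl | ha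
    · simp
    · have : yuleProb a (a + 0 - 1) t = 0 := by rw [yuleProb, if_pos (by omega)]
      rw [this]
      simp
  | succ j =>
    have h3 : yuleProb a (a + (j + 1) - 1) t = ((a + j - 1).choose j : ℝ) * Real.exp (-(a * t)) *
      (1 - Real.exp (-t)) ^ j := by
      rw [yuleProb, if_neg (by omega)]
      congr 3
      · congr 1
        omega
      · omega
    rw [h3]
    have h4 : (((a + (j + 1) - 1 : ℕ)) : ℝ) = a + j := by
      rw [show a + (j + 1) - 1 = a + j by omega]; push_cast; ring
    -- The absorption identity for binomial coefficients matches the inflow from state `k - 1` with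
    -- the derivative of the power.
    have h5 : ((a : ℝ) + j) * ((a + j - 1).choose j : ℝ) =
        ((a + (j + 1) - 1).choose (j + 1) : ℝ) * (j + 1) := by
      rcases Nat.eq_zero_or_pos (a + j) with h0 | h0
      · obtain ⟨rfl, rfl⟩ : a = 0 ∧ j = 0 := by omega
        simp
      · have := Nat.add_one_mul_choose_eq (a + j - 1) j
        rw [show a + j - 1 + 1 = a + j by omega] at this
        rw [show a + (j + 1) - 1 = a + j by omega]
        exact_mod_cast this
    rw [h4]
    simp only [Nat.add_sub_cancel, Pi.pow_apply]
    rw [pow_succ]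
    push_cast
    linear_combination (Real.exp (-(a * t)) * (1 - Real.exp (-t)) ^ j) * (-h5)

/-- The Euler step has a second-order local error, uniformly in `t`, since the derivative of
`yuleProb` is itself Lipschitz on `[0, ∞)`. -/
lemma exists_yuleProb_add_sub_yuleStep_le (a k : ℕ) :
    ∃ C : ℝ, 0 ≤ C ∧ ∀ t h : ℝ, 0 ≤ t → 0 ≤ h →
      |yuleProb a k (t + h) - yuleStep h (fun l => yuleProb a l t) k| ≤ C * h ^ 2 := by
  have hlip : ∀ l : ℕ, ∃ C : ℝ, 0 ≤ C ∧ ∀ t h : ℝ, 0 ≤ t → 0 ≤ h →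
      |yuleProb a l (t + h) - yuleProb a l t| ≤ C * h := by
    intro l
    refine ⟨l * ((l - 1).choose (l - a)) + (l - 1 : ℕ) * ((l - 1 - 1).choose (l - 1 - a)),
      by positivity, fun t h ht hh => ?_⟩
    have := Convex.norm_image_sub_le_of_norm_hasDerivWithin_le (s := Set.Ici 0)
      (f := yuleProb a l) (x := t) (y := t + h)
      (fun x _ => (hasDerivAt_yuleProb a l x).hasDerivWithinAt)
      (C := l * ((l - 1).choose (l - a)) + (l - 1 : ℕ) * ((l - 1 - 1).choose (l - 1 - a)))
      (fun x hx => ?_) (convex_Ici 0) ht (by simp; linarith)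
    · simpa [abs_of_nonneg hh] using this
    · refine (norm_add_le _ _).trans ?_
      rw [norm_neg, norm_mul, norm_mul, Real.norm_natCast, Real.norm_natCast]
      gcongr
      · exact abs_yuleProb_le a l hx
      · exact abs_yuleProb_le a (l - 1) hx
  obtain ⟨C, hC, hCl⟩ := hlip k
  obtain ⟨C', hC', hCl'⟩ := hlip (k - 1)
  refine ⟨k * C + (k - 1 : ℕ) * C', by positivity, fun t h ht hh => ?_⟩
  set D : ℝ → ℝ := fun x => -(k * yuleProb a k x) + ((k - 1 : ℕ) : ℝ) * yuleProb a (k - 1) x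
    with hD
  -- Mean value inequality for the function minus its tangent: the derivative is `D (t + x) - D t`,
  -- of size `O(h)` on an interval of length `h`.
  have := Convex.norm_image_sub_le_of_norm_hasDerivWithin_le (s := Set.Icc 0 h)
      (f := fun x => yuleProb a k (t + x) - D t * x) (f' := fun x => D (t + x) - D t)
      (x := 0) (y := h) (C := (k * C + (k - 1 : ℕ) * C') * h)
      (fun x _ => ?_) (fun x hx => ?_) (convex_Icc 0 h) (by simpa using hh) (by simpa using hh)
  · simp only [add_zero, mul_zero, sub_zero, Real.norm_eq_abs, abs_of_nonneg hh] at this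
    calc _ = |yuleProb a k (t + h) - D t * h - yuleProb a k t| := by
            congr 1; simp only [yuleStep, hD]; ring
      _ ≤ _ := this
      _ = _ := by ring
  · have h1 := (hasDerivAt_yuleProb a k (t + x)).comp_const_add t x
    have h2 := (hasDerivAt_id x).const_mul (D t)
    simp only [id, mul_one] at h2
    exact (h1.sub h2).hasDerivWithinAt
  · have e : D (t + x) - D t = -(k * (yuleProb a k (t + x) - yuleProb a k t)) +
        ((k - 1 : ℕ) : ℝ) * (yuleProb a (k - 1) (t + x) - yuleProb a (k - 1) t) := by
      simp only [hD]; ring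
    rw [e]
    refine (norm_add_le _ _).trans ?_
    rw [norm_neg, norm_mul, norm_mul, Real.norm_natCast, Real.norm_natCast]
    have h1 := hCl t x ht hx.1
    have h2 := hCl' t x ht hx.1
    calc _ ≤ (k : ℝ) * (C * h) + ((k - 1 : ℕ) : ℝ) * (C' * h) := by
          gcongr
          · exact h1.trans (by gcongr; exact hx.2)
          · exact h2.trans (by gcongr; exact hx.2)
      _ = _ := by ring

/-- A quantitative convergence criterion: weights that start from mass `p` at `a` and that evolve
approximately by `yuleStep` are close to `p` times the Yule transition probabilities. -/
lemma exists_abs_sub_yuleProb_le (a k : ℕ) :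
    ∃ C : ℝ, 0 ≤ C ∧ ∀ (J : ℕ) (u : ℕ → ℕ → ℝ) (α ε : ℕ → ℝ) (p : ℝ), |p| ≤ 1 →
      (∀ l, u 0 l = if l = a then p else 0) →
      (∀ j < J, 0 ≤ α j) → (∀ j < J, k * α j ≤ 1) →
      (∀ j < J, ∀ l ≤ k, |u (j + 1) l - yuleStep (α j) (u j) l| ≤ ε j) →
      |u J k - p * yuleProb a k (∑ j ∈ Finset.range J, α j)| ≤
        C * ∑ j ∈ Finset.range J, (ε j + α j ^ 2) := by
  choose C hC hCl using exists_yuleProb_add_sub_yuleStep_le a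
  set B : ℝ := ∑ l ∈ Finset.range (k + 1), C l with hB
  have hB0 : 0 ≤ B := Finset.sum_nonneg fun l _ => hC l
  have hCB : ∀ l ≤ k, C l ≤ B := fun l hl =>
    Finset.single_le_sum (f := C) (fun l _ => hC l) (by simpa [Nat.lt_succ_iff] using hl)
  -- The factor `k + 1` counts the weights up to `k`, and `B` dominates the Euler error constants of
  -- all of them.
  refine ⟨(k + 1) * (1 + B), by positivity, fun J u α ε p hp h0 hα hk hu => ?_⟩
  have key := sum_abs_le_of_approx_yuleStep (K := k) (J := J)
    (d := fun j l => u j l - p * yuleProb a l (∑ i ∈ Finset.range j, α i)) (α := α)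
    (ε := fun j => (1 + B) * (ε j + α j ^ 2)) hα hk ?_
  · rw [← Finset.mul_sum] at key
    have h1 : ∑ l ∈ Finset.range (k + 1),
        |u 0 l - p * yuleProb a l (∑ i ∈ Finset.range 0, α i)| = 0 := by
      refine Finset.sum_eq_zero fun l _ => ?_
      rw [h0, Finset.sum_range_zero, yuleProb_zero]
      split_ifs <;> simp
    rw [h1, zero_add] at key
    refine le_trans ?_ (key.trans_eq (by ring))
    exact Finset.single_le_sum (f := fun l =>
      |u J l - p * yuleProb a l (∑ i ∈ Finset.range J, α i)|) (fun l _ => abs_nonneg _)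
      (Finset.self_mem_range_succ k)
  · intro j hj l hl
    have h1 := hu j hj l hl
    have hpos : 0 ≤ ∑ i ∈ Finset.range j, α i :=
      Finset.sum_nonneg fun i hi => hα i ((Finset.mem_range.1 hi).trans hj)
    have h2 := hCl l _ _ hpos (hα j hj)
    have h3 : (fun l => u j l - p * yuleProb a l (∑ i ∈ Finset.range j, α i)) =
      fun l => u j l - (fun l => p * yuleProb a l (∑ i ∈ Finset.range j, α i)) l := rfl
    have h4 : yuleStep (α j) (fun l => p * yuleProb a l (∑ i ∈ Finset.range j, α i)) l =
      p * yuleStep (α j) (fun l => yuleProb a l (∑ i ∈ Finset.range j, α i)) l := by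
      simp only [yuleStep]; ring
    rw [h3, yuleStep_sub, h4, Finset.sum_range_succ]
    set X := yuleProb a l (∑ i ∈ Finset.range j, α i + α j)
    set Y := yuleStep (α j) (fun l => yuleProb a l (∑ i ∈ Finset.range j, α i)) l
    have h5 : |p * (X - Y)| ≤ B * α j ^ 2 := by
      rw [abs_mul]
      calc _ ≤ 1 * (C l * α j ^ 2) := by gcongr
        _ ≤ _ := by rw [one_mul]; gcongr; exact hCB l hl
    have hε : 0 ≤ ε j := (abs_nonneg _).trans h1
    calc _ = |(u (j + 1) l - yuleStep (α j) (u j) l) - p * (X - Y)| := by congr 1; ring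
      _ ≤ ε j + B * α j ^ 2 := (abs_sub _ _).trans (add_le_add h1 h5)
      _ ≤ _ := by nlinarith [sq_nonneg (α j), mul_nonneg hB0 hε]

/-! ### Finite-dimensional distributions of a Yule process. -/

/-- The event that the process `N` satisfies finitely many constraints `N s = x`. -/
def timeCylinder {Ω : Type*} (N : ℝ → Ω → ℕ) (C : Finset (ℝ × ℕ)) : Set Ω :=
  {ω | ∀ p ∈ C, N p.1 ω = p.2}

lemma timeCylinder_insert {Ω : Type*} (N : ℝ → Ω → ℕ) (C : Finset (ℝ × ℕ)) (s : ℝ) (l : ℕ) :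
    timeCylinder N (insert (s, l) C) = timeCylinder N C ∩ {ω | N s ω = l} := by
  ext ω
  simp [timeCylinder, and_comm]

lemma cond_real_eq_div {Ω : Type*} [MeasurableSpace Ω] (P : Measure Ω) {A : Set Ω}
    (hA : MeasurableSet A) (B : Set Ω) :
    (P[|A]).real B = P.real (A ∩ B) / P.real A := by
  rw [Measure.real, cond_apply hA, ENNReal.toReal_mul, ENNReal.toReal_inv, div_eq_inv_mul]
  rfl

namespace IsYuleProcess

variable {Ω : Type*} [MeasurableSpace Ω] {rate : ℝ} {g : ℕ} {Q : Measure Ω}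
  {N : ℝ → Ω → ℕ}

lemma measurableSet_eq (hN : IsYuleProcess rate g Q N) {s : ℝ} (hs : 0 ≤ s) (l : ℕ) :
    MeasurableSet {ω | N s ω = l} :=
  hN.measurable s hs (measurableSet_singleton l)

lemma measurableSet_timeCylinder (hN : IsYuleProcess rate g Q N) {C : Finset (ℝ × ℕ)}
    (hC : ∀ p ∈ C, 0 ≤ p.1) : MeasurableSet (timeCylinder N C) := by
  have : timeCylinder N C = ⋂ p ∈ C, {ω | N p.1 ω = p.2} := by ext; simp [timeCylinder]
  rw [this]
  exact Finset.measurableSet_biInter _ fun p hp => hN.measurableSet_eq (hC p hp) _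

variable [IsProbabilityMeasure Q]

/-- A product form of the Markov property that survives null events and allows repeated times in the
constraints. Repetitions matter because `c` need not be strictly increasing. -/
lemma markov_timeCylinder (hN : IsYuleProcess rate g Q N) {C : Finset (ℝ × ℕ)} {s T : ℝ} {l : ℕ}
    (hC : ∀ p ∈ C, 0 ≤ p.1 ∧ p.1 ≤ s) (hs : (s, l) ∈ C) (hT : s < T) (j : ℕ) :
    Q.real (timeCylinder N C ∩ {ω | N T ω = j}) * Q.real {ω | N s ω = l} =
      Q.real (timeCylinder N C) * Q.real ({ω | N s ω = l} ∩ {ω | N T ω = j}) := by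
  have hsub : timeCylinder N C ⊆ {ω | N s ω = l} := fun ω hω => hω _ hs
  by_cases h0 : Q (timeCylinder N C) = 0
  · have h1 : Q (timeCylinder N C ∩ {ω | N T ω = j}) = 0 :=
      measure_mono_null Set.inter_subset_left h0
    simp [Measure.real, h0, h1]
  -- A point of the cylinder shows that the constraints are consistent; its values at the sorted
  -- distinct times describe the same event in the form required by `markov`.
  obtain ⟨ω₀, hω₀⟩ := nonempty_of_measure_ne_zero h0
  set S : Finset ℝ := C.image Prod.fst with hS
  have hsS : s ∈ S := Finset.mem_image.2 ⟨_, hs, rfl⟩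
  obtain ⟨n, hn⟩ : ∃ n, S.card = n + 1 :=
    Nat.exists_eq_succ_of_ne_zero (Finset.card_ne_zero_of_mem hsS)
  set e := S.orderEmbOfFin hn with he
  have hS0 : ∀ t ∈ S, 0 ≤ t ∧ t ≤ s := by
    intro t ht
    obtain ⟨p, hp, rfl⟩ := Finset.mem_image.1 ht
    exact hC p hp
  have hrange : ∀ t ∈ S, ∃ a, e a = t := by
    intro t ht
    have : t ∈ Set.range e := by rw [he, Finset.range_orderEmbOfFin]; exact ht
    exact this
  have hlast : e (Fin.last n) = s := by
    obtain ⟨a, ha⟩ := hrange s hsS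
    refine le_antisymm (hS0 _ (Finset.orderEmbOfFin_mem _ _ _)).2 ?_
    rw [← ha]
    exact e.monotone (Fin.le_last a)
  have hset : {ω | ∀ a, N (e a) ω = N (e a) ω₀} = timeCylinder N C := by
    ext ω
    constructor
    · intro h p hp
      obtain ⟨a, ha⟩ := hrange p.1 (Finset.mem_image.2 ⟨p, hp, rfl⟩)
      rw [← ha, h a, ha]
      exact hω₀ p hp
    · intro h a
      obtain ⟨p, hp, hpa⟩ := Finset.mem_image.1 (S.orderEmbOfFin_mem hn a)
      change N (S.orderEmbOfFin hn a) ω = N (S.orderEmbOfFin hn a) ω₀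
      rw [← hpa, h p hp, hω₀ p hp]
  have h0s : 0 ≤ s := (hC _ hs).1
  have key := hN.markov n e (fun a => N (e a) ω₀) T j (hS0 _ (Finset.orderEmbOfFin_mem _ _ _)).1
    e.strictMono (by rw [hlast]; exact hT) (by rw [hset]; exact h0)
  rw [hset, hlast, show N s ω₀ = l from hω₀ _ hs,
    cond_real_eq_div _ (hN.measurableSet_timeCylinder fun p hp => (hC p hp).1),
    cond_real_eq_div _ (hN.measurableSet_eq h0s l)] at key
  have hpos : 0 < Q.real (timeCylinder N C) := ENNReal.toReal_pos h0 (measure_ne_top _ _)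
  have hpos' : 0 < Q.real {ω | N s ω = l} := hpos.trans_le (measureReal_mono hsub)
  rw [div_eq_div_iff hpos.ne' hpos'.ne'] at key
  linarith

lemma infinitesimal_timeCylinder (hN : IsYuleProcess rate g Q N) (l i : ℕ) :
    ∃ r : ℝ → ℝ, r =o[𝓝[>] 0] (fun h : ℝ => h) ∧ ∀ (C : Finset (ℝ × ℕ)) (s h : ℝ),
      (∀ p ∈ C, 0 ≤ p.1 ∧ p.1 ≤ s) → (s, l) ∈ C → 0 < h →
      |Q.real (timeCylinder N C ∩ {ω | N (s + h) ω = l + i}) -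
        Q.real (timeCylinder N C) * yuleMainTerm rate l i h| ≤ r h := by
  obtain ⟨r, hr, hrl⟩ := hN.infinitesimal l i
  -- The absolute value makes the bound nonnegative, which is needed when the cylinder is null.
  refine ⟨fun h => |r h|, hr.abs_left, fun C s h hC hs hh => ?_⟩
  have hsub : timeCylinder N C ⊆ {ω | N s ω = l} := fun ω hω => hω _ hs
  by_cases h0 : Q (timeCylinder N C) = 0
  · have h1 : Q (timeCylinder N C ∩ {ω | N (s + h) ω = l + i}) = 0 :=
      measure_mono_null Set.inter_subset_left h0
    simp [Measure.real, h0, h1]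
  have hpos : 0 < Q.real (timeCylinder N C) := ENNReal.toReal_pos h0 (measure_ne_top _ _)
  have hpos' : 0 < Q.real {ω | N s ω = l} := hpos.trans_le (measureReal_mono hsub)
  have h0s : 0 ≤ s := (hC _ hs).1
  have h2 := hrl s h h0s hh (fun h => h0 (measure_mono_null hsub h))
  rw [cond_real_eq_div _ (hN.measurableSet_eq h0s l)] at h2
  have h3 := hN.markov_timeCylinder hC hs (lt_add_of_pos_right s hh) (l + i)
  have h4 : Q.real (timeCylinder N C ∩ {ω | N (s + h) ω = l + i}) = Q.real (timeCylinder N C) *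
      (Q.real ({ω | N s ω = l} ∩ {ω | N (s + h) ω = l + i}) / Q.real {ω | N s ω = l}) := by
    rw [← mul_div_assoc, eq_div_iff hpos'.ne', h3]
  rw [h4, ← mul_sub, abs_mul, abs_of_pos hpos]
  calc _ ≤ 1 * |r h| := 
        mul_le_mul measureReal_le_one (h2.trans (le_abs_self _)) (abs_nonneg _) zero_le_one
    _ = _ := one_mul _

lemma sum_mul_yuleMainTerm (rate h : ℝ) (u : ℕ → ℝ) (k : ℕ) :
    ∑ l ∈ Finset.range (k + 1), u l * yuleMainTerm rate l (k - l) h =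
      yuleStep (rate * h) u k := by
  rw [Finset.sum_range_succ]
  cases k with
  | zero => simp [yuleMainTerm, yuleStep]
  | succ k =>
    rw [Finset.sum_range_succ, Finset.sum_eq_zero]
    · simp [yuleMainTerm, yuleStep]
      ring
    · intro l hl
      have := Finset.mem_range.1 hl
      rw [yuleMainTerm, if_neg (by omega), if_neg (by omega), mul_zero]

/-- Splitting by the value `l` at time `s + t` reduces the step to the infinitesimal rates; monotone
paths leave only the finitely many `l ≤ j`. The error is uniform in the cylinder and in the times,
so it can be summed over a subdivision. -/
lemma exists_abs_sub_yuleStep_le (hN : IsYuleProcess rate g Q N) (k : ℕ) :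
    ∃ r : ℝ → ℝ, r =o[𝓝[>] 0] (fun h : ℝ => h) ∧
      ∀ (C : Finset (ℝ × ℕ)) (s t h : ℝ), (∀ p ∈ C, 0 ≤ p.1 ∧ p.1 ≤ s) → 0 ≤ s → 0 ≤ t →
      0 < h → ∀ j ≤ k,
      |Q.real (timeCylinder N C ∩ {ω | N (s + t + h) ω = j}) -
        yuleStep (rate * h) (fun l => Q.real (timeCylinder N C ∩ {ω | N (s + t) ω = l})) j| ≤ r h := by
  choose r hr hrl using fun l i => hN.infinitesimal_timeCylinder l i
  refine ⟨fun h => ∑ j ∈ Finset.range (k + 1), ∑ l ∈ Finset.range (j + 1), |r l (j - l) h|,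
    IsLittleO.fun_sum fun j _ => IsLittleO.fun_sum fun l _ => (hr _ _).abs_left,
    fun C s t h hC hs ht hh j hj => ?_⟩
  have hmeas := hN.measurableSet_timeCylinder fun p hp => (hC p hp).1
  have hdec : Q.real (timeCylinder N C ∩ {ω | N (s + t + h) ω = j}) =
      ∑ l ∈ Finset.range (j + 1),
        Q.real (timeCylinder N (insert (s + t, l) C) ∩ {ω | N (s + t + h) ω = j}) := by
    rw [← measureReal_biUnion_finset]
    · refine measureReal_congr ?_
      filter_upwards [hN.mono] with ω hω
      have h1 : N (s + t) ω ≤ N (s + t + h) ω :=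
        hω (by simp; linarith) (by simp; linarith) (by linarith)
      refine propext ⟨fun h2 => ?_, fun h2 => ?_⟩
      · have h4 : N (s + t + h) ω = j := h2.2
        refine Set.mem_iUnion₂.2 ⟨N (s + t) ω, by rw [Finset.mem_range]; omega, ?_⟩
        rw [timeCylinder_insert]
        exact ⟨⟨h2.1, rfl⟩, h2.2⟩
      · obtain ⟨l, _, hl⟩ := Set.mem_iUnion₂.1 h2
        rw [timeCylinder_insert] at hl
        exact ⟨hl.1.1, hl.2⟩
    · intro l _ l' _ hll'
      rw [Function.onFun, Set.disjoint_left]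
      intro ω h1 h2
      rw [timeCylinder_insert] at h1 h2
      exact hll' (h1.1.2.symm.trans h2.1.2)
    · intro l _
      rw [timeCylinder_insert]
      exact (hmeas.inter (hN.measurableSet_eq (by linarith) _)).inter
        (hN.measurableSet_eq (by linarith) _)
  rw [hdec, ← sum_mul_yuleMainTerm, ← Finset.sum_sub_distrib]
  refine (Finset.abs_sum_le_sum_abs _ _).trans ?_
  refine le_trans ?_ (Finset.single_le_sum
    (f := fun j => ∑ l ∈ Finset.range (j + 1), |r l (j - l) h|)
    (fun j _ => Finset.sum_nonneg fun l _ => abs_nonneg _)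
    (Finset.mem_range.2 (Nat.lt_succ_of_le hj)))
  refine Finset.sum_le_sum fun l hl => ?_
  have hl := Finset.mem_range.1 hl
  have h5 := hrl l (j - l) (insert (s + t, l) C) (s + t) h ?_ (Finset.mem_insert_self _ _) hh
  · rw [show l + (j - l) = j by omega] at h5
    rw [timeCylinder_insert] at h5 ⊢
    exact h5.trans (le_abs_self _)
  · intro p hp
    rcases Finset.mem_insert.1 hp with rfl | hp
    · exact ⟨by simp; linarith, le_rfl⟩
    · exact ⟨(hC p hp).1, by linarith [(hC p hp).2]⟩

/-- In a subdivision of `[s, s + t]` into `n` steps the total error is of order `n * r (t / n) +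
(rate * t) ^ 2 / n`, which tends to `0`. The left side does not depend on `n`, so equality holds. -/
lemma real_timeCylinder_inter (hN : IsYuleProcess rate g Q N) (hrate : 0 ≤ rate)
    {C : Finset (ℝ × ℕ)} {s : ℝ} {a : ℕ} (hC : ∀ p ∈ C, 0 ≤ p.1 ∧ p.1 ≤ s) (hs : (s, a) ∈ C)
    {t : ℝ} (ht : 0 ≤ t) (k : ℕ) :
    Q.real (timeCylinder N C ∩ {ω | N (s + t) ω = k}) =
      Q.real (timeCylinder N C) * yuleProb a k (rate * t) := by
  obtain ⟨B, hB, hBl⟩ := exists_abs_sub_yuleProb_le a k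
  obtain ⟨r, hr, hrl⟩ := hN.exists_abs_sub_yuleStep_le k
  have h0s : 0 ≤ s := (hC _ hs).1
  have hp : |Q.real (timeCylinder N C)| ≤ 1 := by
    rw [abs_of_nonneg measureReal_nonneg]; exact measureReal_le_one
  have hinit : ∀ l, Q.real (timeCylinder N C ∩ {ω | N s ω = l}) =
      if l = a then Q.real (timeCylinder N C) else 0 := by
    intro l
    split_ifs with h
    · rw [Set.inter_eq_left.2]
      intro ω hω
      rw [h]
      exact hω _ hs
    · rw [Set.disjoint_iff_inter_eq_empty.1, measureReal_empty]
      rw [Set.disjoint_left]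
      intro ω hω hω'
      exact h (hω'.symm.trans (hω _ hs))
  rcases ht.eq_or_lt with rfl | ht
  · rw [add_zero, mul_zero, hinit, yuleProb_zero]
    split_ifs <;> simp
  have hbound : ∀ᶠ n : ℕ in atTop,
      |Q.real (timeCylinder N C ∩ {ω | N (s + t) ω = k}) -
        Q.real (timeCylinder N C) * yuleProb a k (rate * t)| ≤
      B * (t * (r (t / n) / (t / n)) + (rate * t) ^ 2 / n) := by
    -- The lower bound on `n` makes `k` times the step length at most `1`, as the contraction
    -- requires.
    filter_upwards [eventually_gt_atTop 0, eventually_ge_atTop ⌈k * (rate * t)⌉₊] with n hn hn'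
    have hn0 : (0 : ℝ) < n := by exact_mod_cast hn
    have hk : k * (rate * t) ≤ n := (Nat.le_ceil _).trans (by exact_mod_cast hn')
    have hnt : (n : ℝ) * (t / n) = t := by field_simp
    have := hBl n (fun j l => Q.real (timeCylinder N C ∩ {ω | N (s + j * (t / n)) ω = l}))
      (fun _ => rate * (t / n)) (fun _ => r (t / n)) _ hp (by simpa using hinit)
      (fun j _ => by positivity)
      (fun j _ => by rw [← mul_div_assoc, ← mul_div_assoc, div_le_one hn0]; exact hk)
      (fun j _ l hl => by
        have := hrl C s (j * (t / n)) (t / n) hC h0s (by positivity) (by positivity) l hl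
        simp only [Nat.cast_add, Nat.cast_one, add_mul, one_mul]
        rw [← add_assoc]
        exact this)
    simp only [Finset.sum_const, Finset.card_range, nsmul_eq_mul, hnt] at this
    rw [mul_left_comm, hnt] at this
    refine this.trans_eq ?_
    congr 1
    field_simp
  have hlim : Tendsto (fun n : ℕ => B * (t * (r (t / n) / (t / n)) + (rate * t) ^ 2 / n)) atTop
      (𝓝 (B * (t * 0 + 0))) := by
    have h1 : Tendsto (fun n : ℕ => t / (n : ℝ)) atTop (𝓝[>] 0) := by
      refine tendsto_nhdsWithin_iff.2 ⟨tendsto_const_div_atTop_nhds_zero_nat t, ?_⟩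
      filter_upwards [eventually_gt_atTop 0] with n hn
      have hn0 : (0 : ℝ) < n := by exact_mod_cast hn
      exact div_pos ht hn0
    exact (((hr.tendsto_div_nhds_zero.comp h1).const_mul t).add
      (tendsto_const_div_atTop_nhds_zero_nat _)).const_mul B
  have := ge_of_tendsto hlim hbound
  rw [mul_zero, add_zero, mul_zero] at this
  exact sub_eq_zero.1 (abs_nonpos_iff.1 this)

lemma real_forall_eq_prod (hN : IsYuleProcess rate g Q N) (hrate : 0 ≤ rate) (b : ℕ)
    (T : Fin (b + 1) → ℝ) (hT0 : 0 ≤ T 0) (hT : Monotone T) (k : Fin (b + 1) → ℕ) :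
    Q.real {ω | ∀ l, N (T l) ω = k l} = Q.real {ω | N (T 0) ω = k 0} *
      ∏ l : Fin b, yuleProb (k l.castSucc) (k l.succ) (rate * (T l.succ - T l.castSucc)) := by
  induction b with
  | zero => simp [Fin.forall_fin_one]
  | succ b ih =>
    have h1 := ih (fun l => T l.castSucc) hT0
      (fun _ _ h => hT (Fin.castSucc_le_castSucc_iff.2 h)) (fun l => k l.castSucc)
    set C : Finset (ℝ × ℕ) :=
      Finset.univ.image (fun l : Fin (b + 1) => (T l.castSucc, k l.castSucc)) with hCdef
    have hcyl : {ω | ∀ l : Fin (b + 1), N (T l.castSucc) ω = k l.castSucc} = timeCylinder N C := by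
      ext ω
      simp [timeCylinder, hCdef]
    have hset : {ω | ∀ l, N (T l) ω = k l} = timeCylinder N C ∩
        {ω | N (T (Fin.last b).castSucc + (T (Fin.last (b + 1)) - T (Fin.last b).castSucc)) ω =
          k (Fin.last (b + 1))} := by
      rw [← hcyl]
      ext ω
      simp [Fin.forall_fin_succ']
    rw [hset, hN.real_timeCylinder_inter hrate (a := k (Fin.last b).castSucc), ← hcyl, h1,
      Fin.prod_univ_castSucc, mul_assoc]
    · rfl
    · intro p hp
      obtain ⟨l, _, rfl⟩ := Finset.mem_image.1 hp
      exact ⟨hT0.trans (hT (Fin.zero_le _)),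
        hT (Fin.castSucc_le_castSucc_iff.2 (Fin.le_last l))⟩
    · exact Finset.mem_image.2 ⟨Fin.last b, Finset.mem_univ _, rfl⟩
    · exact sub_nonneg.2 (hT (Fin.le_last _))

/-- The finite-dimensional distributions of a Yule process. -/
lemma real_forall_eq_prod_cons (hN : IsYuleProcess rate g Q N) (hrate : 0 ≤ rate) {b : ℕ}
    (T : Fin b → ℝ) (hT0 : ∀ l, 0 ≤ T l) (hT : Monotone T) (k : Fin b → ℕ) :
    Q.real {ω | ∀ l, N (T l) ω = k l} =
      ∏ l : Fin b, yuleProb ((Fin.cons g k : Fin (b + 1) → ℕ) l.castSucc) (k l)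
        (rate * (T l - (Fin.cons 0 T : Fin (b + 1) → ℝ) l.castSucc)) := by
  have h1 := hN.real_forall_eq_prod hrate b (Fin.cons 0 T) (by simp)
    (monotone_finCons hT0 hT) (Fin.cons g k)
  have h2 : Q.real {ω | N 0 ω = g} = 1 := by
    rw [Measure.real, (prob_compl_eq_zero_iff (hN.measurableSet_eq le_rfl g)).1 hN.initial]
    rfl
  have h3 : Q.real {ω | ∀ l, N (T l) ω = k l} = Q.real {ω | ∀ l : Fin (b + 1),
      N ((Fin.cons 0 T : Fin (b + 1) → ℝ) l) ω = (Fin.cons g k : Fin (b + 1) → ℕ) l} := by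
    refine measureReal_congr ?_
    filter_upwards [hN.initial] with ω hω
    refine propext ?_
    change (∀ l, _) ↔ (∀ l, _)
    rw [Fin.forall_fin_succ]
    simp [hω]
  rw [h3, h1]
  simp [h2]

end IsYuleProcess

/-! ### Degrees, edge counts and the normalisation of the attachment probabilities. -/

namespace BAGraph

instance : Countable BAGraph :=
  Function.Injective.countable (f := fun G : BAGraph => (G.numVertices, G.edges)) fun G H h => by
    rw [Prod.mk.injEq] at h
    exact BAGraph.ext h.1 h.2

instance : DiscreteMeasurableSpace BAGraph := ⟨fun _ => trivial⟩

lemma degree_addVertex (G : BAGraph) (j : ℕ) : G.addVertex.degree j = G.degree j := rfl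

lemma degree_addEdge (G : BAGraph) (a b j : ℕ) :
    (G.addEdge a b).degree j =
      G.degree j + (if j = a then 1 else 0) + (if j = b then 1 else 0) := by
  simp only [degree, addEdge, Multiset.map_cons, Multiset.count_cons]
  omega

lemma addEdge_right_injective (G : BAGraph) (a : ℕ) : Function.Injective (G.addEdge a) := by
  intro b b' h
  have h1 : (a, b) ::ₘ G.edges = (a, b') ::ₘ G.edges := congrArg BAGraph.edges h
  rw [Multiset.cons_inj_left] at h1
  exact congrArg Prod.snd h1

/-- The graph has the vertices `v_1, …, v_N` and has `M` edges, which join some of these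
vertices. -/
structure HasSize (G : BAGraph) (N M : ℕ) : Prop where
  card_edges : G.edges.card = M
  fst_mem : ∀ e ∈ G.edges, e.1 ∈ Finset.Icc 1 N
  snd_mem : ∀ e ∈ G.edges, e.2 ∈ Finset.Icc 1 N

lemma hasSize_empty : empty.HasSize 0 0 := ⟨rfl, by simp [empty], by simp [empty]⟩

lemma HasSize.addVertex {G : BAGraph} {N M : ℕ} (h : G.HasSize N M) :
    G.addVertex.HasSize (N + 1) M :=
  ⟨h.card_edges, fun e he => Finset.Icc_subset_Icc_right N.le_succ (h.fst_mem e he),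
    fun e he => Finset.Icc_subset_Icc_right N.le_succ (h.snd_mem e he)⟩

lemma HasSize.addEdge {G : BAGraph} {N M : ℕ} (h : G.HasSize N M) {a b : ℕ}
    (ha : a ∈ Finset.Icc 1 N) (hb : b ∈ Finset.Icc 1 N) :
    (G.addEdge a b).HasSize N (M + 1) := by
  refine ⟨by simp [BAGraph.addEdge, h.card_edges], fun e he => ?_, fun e he => ?_⟩
  · rcases Multiset.mem_cons.1 he with rfl | he
    exacts [ha, h.fst_mem e he]
  · rcases Multiset.mem_cons.1 he with rfl | he
    exacts [hb, h.snd_mem e he]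

lemma HasSize.degree_eq_zero {G : BAGraph} {N M : ℕ} (h : G.HasSize N M) {j : ℕ} (hj : N < j) :
    G.degree j = 0 := by
  have h1 : j ∉ G.edges.map Prod.fst := by
    intro h1
    obtain ⟨e, he, rfl⟩ := Multiset.mem_map.1 h1
    have := Finset.mem_Icc.1 (h.fst_mem e he)
    omega
  have h2 : j ∉ G.edges.map Prod.snd := by
    intro h2
    obtain ⟨e, he, rfl⟩ := Multiset.mem_map.1 h2
    have := Finset.mem_Icc.1 (h.snd_mem e he)
    omega
  simp [degree, Multiset.count_eq_zero_of_notMem h1, Multiset.count_eq_zero_of_notMem h2]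

lemma HasSize.sum_degree {G : BAGraph} {N M : ℕ} (h : G.HasSize N M) :
    ∑ j ∈ Finset.Icc 1 N, G.degree j = 2 * M := by
  simp only [degree]
  rw [Finset.sum_add_distrib, Multiset.sum_count_eq_card, Multiset.sum_count_eq_card,
    Multiset.card_map, Multiset.card_map, h.card_edges, two_mul]
  · intro a ha
    obtain ⟨e, he, rfl⟩ := Multiset.mem_map.1 ha
    exact h.snd_mem e he
  · intro a ha
    obtain ⟨e, he, rfl⟩ := Multiset.mem_map.1 ha
    exact h.fst_mem e he

end BAGraph

/-- The denominator is the degree sum `2 * (m * n + r)` plus one for the half-edge already issued by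
the new vertex. The index `r + 1 + 1` belongs to the edge added after `r` edges of the block. -/
lemma sum_attachProb {m n r : ℕ} {G : BAGraph} (hG : G.HasSize (n + 1) (m * n + r)) :
    ∑ j ∈ Finset.Icc 1 (n + 1), attachProb m n (r + 1 + 1) G j = 1 := by
  have h1 : ∀ j, attachProb m n (r + 1 + 1) G j =
      ((G.degree j : ℝ) + if j = n + 1 then 1 else 0) / (2 * ((m : ℝ) * n + r) + 1) := by
    intro j
    have : 2 * ((m : ℝ) * n + ((r + 1 + 1 : ℕ) : ℝ) - 1) - 1 = 2 * ((m : ℝ) * n + r) + 1 := by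
      push_cast; ring
    rw [attachProb, this]
    split_ifs <;> simp
  have h2 : ∑ j ∈ Finset.Icc 1 (n + 1), (G.degree j : ℝ) = 2 * ((m : ℝ) * n + r) := by
    exact_mod_cast hG.sum_degree
  simp only [h1]
  rw [← Finset.sum_div, Finset.sum_add_distrib, h2, Finset.sum_ite_eq' , if_pos (by simp)]
  exact div_self (by positivity)

/-! ### Events of the past and conditioning on complete histories. -/

/-- The event `E` is determined by the process `G` up to time `t`. -/
def DependsOnPast {Ω β : Type*} (G : ℕ → Ω → β) (t : ℕ) (E : Set Ω) : Prop :=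
  ∀ ω ω', (∀ s ≤ t, G s ω = G s ω') → ω ∈ E → ω' ∈ E

/-- The event that `G` takes the same values as at the sample point `ω₀` up to time `t`. -/
def historyEvent {Ω β : Type*} (G : ℕ → Ω → β) (t : ℕ) (ω₀ : Ω) : Set Ω :=
  {ω | ∀ s ≤ t, G s ω = G s ω₀}

namespace DependsOnPast

variable {Ω β : Type*} {G : ℕ → Ω → β} {t : ℕ} {E F : Set Ω}

lemma univ : DependsOnPast G t Set.univ := fun _ _ _ _ => trivial

lemma inter (hE : DependsOnPast G t E) (hF : DependsOnPast G t F) : DependsOnPast G t (E ∩ F) :=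
  fun ω ω' h hω => ⟨hE ω ω' h hω.1, hF ω ω' h hω.2⟩

lemma mono (hE : DependsOnPast G t E) {t' : ℕ} (ht : t ≤ t') : DependsOnPast G t' E :=
  fun ω ω' h => hE ω ω' fun s hs => h s (hs.trans ht)

lemma of_eq {γ : Type*} (f : β → γ) (x : γ) : DependsOnPast G t {ω | f (G t ω) = x} :=
  fun ω ω' h hω => by
    have h1 : f (G t ω) = x := hω
    change f (G t ω') = x
    rw [← h t le_rfl, h1]

variable [MeasurableSpace Ω] [MeasurableSpace β] [MeasurableSingletonClass β]

lemma measurableSet_historyEvent (hG : ∀ t, Measurable (G t)) (t : ℕ) (ω₀ : Ω) :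
    MeasurableSet (historyEvent G t ω₀) := by
  have : historyEvent G t ω₀ = ⋂ s ∈ Finset.range (t + 1), {ω | G s ω = G s ω₀} := by
    ext; simp [historyEvent]
  rw [this]
  exact Finset.measurableSet_biInter _ fun s _ => hG s (measurableSet_singleton _)

/-- To compute the probability of `B` given an event `E` of the past, it is enough to condition on
complete histories. -/
lemma real_inter_eq_mul [Countable β] (hE : DependsOnPast G t E) (P : Measure Ω) [IsFiniteMeasure P]
    (hG : ∀ t, Measurable (G t)) {B : Set Ω} (hB : MeasurableSet B) {c : ℝ} (hc : 0 ≤ c)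
    (h : ∀ ω₀ ∈ E, P (historyEvent G t ω₀) ≠ 0 →
      P.real (historyEvent G t ω₀ ∩ B) = P.real (historyEvent G t ω₀) * c) :
    P.real (E ∩ B) = P.real E * c := by
  -- The history takes countably many values, so `E` is a countable disjoint union of history
  -- events, and measurability of `E` comes for free.
  set X : Ω → Fin (t + 1) → β := fun ω s => G s ω with hX
  have hfib : ∀ ω₀, X ⁻¹' {X ω₀} = historyEvent G t ω₀ := by
    intro ω₀
    ext ω
    constructor
    · intro h s hs
      exact congrFun (Set.mem_singleton_iff.1 h) (⟨s, Nat.lt_succ_of_le hs⟩ : Fin (t + 1))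
    · intro h
      exact funext fun s => h s (Nat.lt_succ_iff.1 s.2)
  have hEX : E = ⋃ x : X '' E, X ⁻¹' {x.1} := by
    ext ω
    rw [Set.mem_iUnion]
    constructor
    · intro hω
      exact ⟨⟨X ω, ω, hω, rfl⟩, rfl⟩
    · rintro ⟨⟨x, ω', hω', rfl⟩, hω⟩
      rw [hfib] at hω
      exact hE ω' ω (fun s hs => (hω s hs).symm) hω'
  have hdisj : Pairwise (Function.onFun Disjoint fun x : X '' E => X ⁻¹' {x.1}) := by
    intro x y hxy
    rw [Function.onFun, Set.disjoint_left]
    intro ω h1 h2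
    exact hxy (Subtype.ext ((Set.mem_singleton_iff.1 h1).symm.trans (Set.mem_singleton_iff.1 h2)))
  have hmeas : ∀ x : X '' E, MeasurableSet (X ⁻¹' {x.1}) := by
    rintro ⟨x, ω', hω', rfl⟩
    rw [hfib]
    exact measurableSet_historyEvent hG t ω'
  have key : P (E ∩ B) = P E * ENNReal.ofReal c := by
    conv_lhs => rw [hEX, Set.iUnion_inter]
    conv_rhs => rw [hEX]
    rw [measure_iUnion hdisj hmeas, measure_iUnion
      (fun x y hxy => (hdisj hxy).mono Set.inter_subset_left Set.inter_subset_left)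
      (fun x => (hmeas x).inter hB), ← ENNReal.tsum_mul_right]
    refine tsum_congr ?_
    rintro ⟨x, ω', hω', rfl⟩
    simp only
    rw [hfib]
    by_cases h0 : P (historyEvent G t ω') = 0
    · rw [h0, zero_mul]
      exact measure_mono_null Set.inter_subset_left h0
    · have := h ω' hω' h0
      rw [← ENNReal.ofReal_toReal (measure_ne_top P (historyEvent G t ω' ∩ B)),
        ← ENNReal.ofReal_toReal (measure_ne_top P (historyEvent G t ω')),
        ← ENNReal.ofReal_mul ENNReal.toReal_nonneg]
      exact congrArg _ this
  rw [Measure.real, key, ENNReal.toReal_mul, ENNReal.toReal_ofReal hc, Measure.real]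

end DependsOnPast

/-! ### Almost sure structure of the graph process. -/

namespace IsBAProcess

variable {Ω : Type*} [MeasurableSpace Ω] {m : ℕ} {P : Measure Ω} {G : ℕ → Ω → BAGraph}

lemma measurableSet_step (hG : IsBAProcess m P G) (t : ℕ) (f : BAGraph → BAGraph) :
    MeasurableSet {ω | G (t + 1) ω = f (G t ω)} :=
  measurableSet_eq_fun (hG.measurable _) ((measurable_of_countable f).comp (hG.measurable _))

lemma measurableSet_degree (hG : IsBAProcess m P G) (t i k : ℕ) :
    MeasurableSet {ω | (G t ω).degree i = k} :=
  hG.measurable t (MeasurableSet.of_discrete (s := {g : BAGraph | g.degree i = k}))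

variable [IsProbabilityMeasure P]

lemma real_history_inter_step (hG : IsBAProcess m P G) {n r j : ℕ} (hr : 1 ≤ r) (hrm : r ≤ m)
    (hj : j ∈ Finset.Icc 1 (n + 1)) (ω₀ : Ω)
    (h0 : P (historyEvent G (n * (m + 1) + r) ω₀) ≠ 0) :
    P.real (historyEvent G (n * (m + 1) + r) ω₀ ∩
        {ω | G (n * (m + 1) + r + 1) ω = (G (n * (m + 1) + r) ω).addEdge (n + 1) j}) =
      P.real (historyEvent G (n * (m + 1) + r) ω₀) *
        attachProb m n (r + 1) (G (n * (m + 1) + r) ω₀) j := by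
  have h1 := hG.edge_step n (r + 1) (by omega) (by omega) (fun s => G s ω₀) h0 j
    (Finset.mem_Icc.1 hj).1 (Finset.mem_Icc.1 hj).2
  change (P[|historyEvent G (n * (m + 1) + r) ω₀]).real
    {ω | G (n * (m + 1) + r + 1) ω = (G (n * (m + 1) + r) ω₀).addEdge (n + 1) j} =
    attachProb m n (r + 1) (G (n * (m + 1) + r) ω₀) j at h1
  have hpos : P.real (historyEvent G (n * (m + 1) + r) ω₀) ≠ 0 :=
    (ENNReal.toReal_pos h0 (measure_ne_top _ _)).ne'
  rw [cond_real_eq_div _ (DependsOnPast.measurableSet_historyEvent hG.measurable _ _),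
    div_eq_iff hpos] at h1
  rw [mul_comm (P.real _), ← h1]
  congr 1
  ext ω
  refine and_congr_right fun h => ?_
  have := h (n * (m + 1) + r) le_rfl
  simp only [Set.mem_ofPred_eq, this]

lemma real_inter_step (hG : IsBAProcess m P G) {n r j : ℕ} (hr : 1 ≤ r) (hrm : r ≤ m)
    (hj : j ∈ Finset.Icc 1 (n + 1)) {E : Set Ω} (hE : DependsOnPast G (n * (m + 1) + r) E)
    {c : ℝ} (hc : 0 ≤ c)
    (hEc : ∀ ω ∈ E, attachProb m n (r + 1) (G (n * (m + 1) + r) ω) j = c) :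
    P.real (E ∩ {ω | G (n * (m + 1) + r + 1) ω =
      (G (n * (m + 1) + r) ω).addEdge (n + 1) j}) = P.real E * c := by
  refine hE.real_inter_eq_mul P hG.measurable
    (hG.measurableSet_step _ fun g => g.addEdge (n + 1) j) hc fun ω₀ hω₀ h0 => ?_
  rw [hG.real_history_inter_step hr hrm hj ω₀ h0, hEc ω₀ hω₀]

/-- The prescribed probabilities of the different endpoints belong to disjoint events and sum to `1`
for a graph of the right size, so nothing else can happen with positive probability. -/
lemma ae_exists_addEdge_of_hasSize (hG : IsBAProcess m P G) {n r : ℕ} (hr : r + 1 ≤ m)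
    (hsize : ∀ᵐ ω ∂P, (G (n * (m + 1) + (r + 1)) ω).HasSize (n + 1) (m * n + r)) :
    ∀ᵐ ω ∂P, ∃ j ∈ Finset.Icc 1 (n + 1),
      G (n * (m + 1) + (r + 1) + 1) ω = (G (n * (m + 1) + (r + 1)) ω).addEdge (n + 1) j := by
  set t := n * (m + 1) + (r + 1) with ht
  set S : ℕ → Set Ω := fun j => {ω | G (t + 1) ω = (G t ω).addEdge (n + 1) j} with hS
  have hSm : ∀ j, MeasurableSet (S j) := fun j =>
    hG.measurableSet_step t fun g => g.addEdge (n + 1) j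
  have hBm : MeasurableSet (⋃ j ∈ Finset.Icc 1 (n + 1), S j) :=
    Finset.measurableSet_biUnion _ fun j _ => hSm j
  have hone : P.real (Set.univ ∩ ⋃ j ∈ Finset.Icc 1 (n + 1), S j) = P.real Set.univ * 1 := by
    refine (DependsOnPast.univ (G := G) (t := t)).real_inter_eq_mul P hG.measurable hBm
      zero_le_one fun ω₀ _ h0 => ?_
    have hsz : (G t ω₀).HasSize (n + 1) (m * n + r) := by
      obtain ⟨ω, hω, hω'⟩ := nonempty_of_measure_ne_zero
        ((measure_inter_conull (s := historyEvent G t ω₀) hsize).trans_ne h0)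
      rw [← hω t le_rfl]
      exact hω'
    rw [Set.inter_iUnion₂, measureReal_biUnion_finset]
    · rw [← sum_attachProb hsz, Finset.mul_sum]
      exact Finset.sum_congr rfl fun j hj =>
        hG.real_history_inter_step (by omega) hr hj ω₀ h0
    · intro j _ j' _ hjj'
      rw [Function.onFun, Set.disjoint_left]
      intro ω h1 h2
      exact hjj' ((G t ω).addEdge_right_injective _ (h1.2.symm.trans h2.2))
    · intro j _
      exact (DependsOnPast.measurableSet_historyEvent hG.measurable _ _).inter (hSm j)
  rw [Set.univ_inter, mul_one, probReal_univ] at hone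
  have h1 : P (⋃ j ∈ Finset.Icc 1 (n + 1), S j) = 1 := by
    rw [← ENNReal.ofReal_toReal (measure_ne_top P _)]
    exact (congrArg _ hone).trans ENNReal.ofReal_one
  have h2 := (prob_compl_eq_zero_iff hBm).2 h1
  filter_upwards [measure_eq_zero_iff_ae_notMem.1 h2] with ω hω
  simpa [hS, and_assoc] using hω

/-- Size and transition form must be proved together: the size gives total probability `1`, hence
almost surely one legal edge, hence the next size. -/
lemma ae_hasSize (hG : IsBAProcess m P G) (n : ℕ) :
    (∀ᵐ ω ∂P, (G (n * (m + 1)) ω).HasSize n (m * n)) ∧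
      ∀ r ≤ m, ∀ᵐ ω ∂P, (G (n * (m + 1) + (r + 1)) ω).HasSize (n + 1) (m * n + r) := by
  have hblock : ∀ n, (∀ᵐ ω ∂P, (G (n * (m + 1)) ω).HasSize n (m * n)) →
      ∀ r ≤ m, ∀ᵐ ω ∂P, (G (n * (m + 1) + (r + 1)) ω).HasSize (n + 1) (m * n + r) := by
    intro n hn r
    induction r with
    | zero =>
      intro _
      filter_upwards [hn, hG.vertex_step n] with ω h1 h2
      rw [zero_add, h2]
      exact h1.addVertex
    | succ r ih =>
      intro hr
      have h1 := ih (by omega)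
      filter_upwards [h1, hG.ae_exists_addEdge_of_hasSize hr h1] with ω h1 ⟨j, hj, h2⟩
      rw [← add_assoc _ (r + 1), h2, ← add_assoc]
      exact h1.addEdge (by simp) hj
  suffices h : ∀ᵐ ω ∂P, (G (n * (m + 1)) ω).HasSize n (m * n) from ⟨h, hblock n h⟩
  induction n with
  | zero =>
    filter_upwards [hG.start] with ω hω
    rw [zero_mul, hω]
    exact BAGraph.hasSize_empty
  | succ n ih =>
    filter_upwards [hblock n ih m le_rfl] with ω hω
    rw [add_mul, one_mul]
    exact hω

lemma ae_exists_addEdge (hG : IsBAProcess m P G) (n : ℕ) {r : ℕ} (hr : 1 ≤ r) (hrm : r ≤ m) :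
    ∀ᵐ ω ∂P, ∃ j ∈ Finset.Icc 1 (n + 1),
      G (n * (m + 1) + r + 1) ω = (G (n * (m + 1) + r) ω).addEdge (n + 1) j := by
  obtain ⟨r, rfl⟩ := Nat.exists_eq_add_of_le' hr
  exact hG.ae_exists_addEdge_of_hasSize hrm ((hG.ae_hasSize n).2 r (by omega))

end IsBAProcess

/-! ### The degree of an old vertex as a linear birth chain. -/

/-- The factor by which the degree of an old vertex has to be multiplied to get the probability that
this degree increases between the times `t` and `t + 1`. -/
noncomputable def attachRate (m t : ℕ) : ℝ :=
  if t % (m + 1) = 0 then 0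
  else 1 / (2 * ((m : ℝ) * (t / (m + 1) : ℕ) + (t % (m + 1) : ℕ)) - 1)

lemma attachRate_zero (m n : ℕ) : attachRate m (n * (m + 1)) = 0 := by
  simp [attachRate]

lemma attachRate_add {m r : ℕ} (n : ℕ) (hr : 1 ≤ r) (hrm : r ≤ m) :
    attachRate m (n * (m + 1) + r) = 1 / (2 * ((m : ℝ) * n + r) - 1) := by
  have h1 : (n * (m + 1) + r) % (m + 1) = r := by
    rw [add_comm, Nat.add_mul_mod_self_right, Nat.mod_eq_of_lt (by omega)]
  have h2 : (n * (m + 1) + r) / (m + 1) = n := by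
    rw [add_comm, Nat.add_mul_div_right _ _ (Nat.succ_pos m), Nat.div_eq_of_lt (by omega), zero_add]
  rw [attachRate, h1, h2, if_neg (by omega)]

namespace IsBAProcess

variable {Ω : Type*} [MeasurableSpace Ω] {m : ℕ} {P : Measure Ω} {G : ℕ → Ω → BAGraph}
  [IsProbabilityMeasure P]

/-- Since `i ≤ n`, the vertex can gain only the far end of the new edge. On degree `l` this has
probability `l * α`, so the weights obey `yuleStep` exactly. -/
lemma real_inter_degree_edge_step (hG : IsBAProcess m P G) {i n r : ℕ} (hi : 1 ≤ i) (hin : i ≤ n)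
    (hr : 1 ≤ r) (hrm : r ≤ m) {E : Set Ω} (hEm : MeasurableSet E)
    (hE : DependsOnPast G (n * (m + 1) + r) E) (k : ℕ) :
    P.real (E ∩ {ω | (G (n * (m + 1) + r + 1) ω).degree i = k}) =
      yuleStep (1 / (2 * ((m : ℝ) * n + r) - 1))
        (fun l => P.real (E ∩ {ω | (G (n * (m + 1) + r) ω).degree i = l})) k := by
  set t := n * (m + 1) + r with ht
  set α : ℝ := 1 / (2 * ((m : ℝ) * n + r) - 1) with hα
  have hα0 : 0 ≤ α := by
    have h1 : (1 : ℝ) ≤ r := by exact_mod_cast hr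
    have h2 : (0 : ℝ) ≤ m * n := by positivity
    exact one_div_nonneg.2 (by linarith)
  set H : Set Ω := {ω | G (t + 1) ω = (G t ω).addEdge (n + 1) i} with hH
  have hHm : MeasurableSet H := hG.measurableSet_step t fun g => g.addEdge (n + 1) i
  set F : ℕ → Set Ω := fun l => E ∩ {ω | (G t ω).degree i = l} with hF
  have hFm : ∀ l, MeasurableSet (F l) := fun l => hEm.inter (hG.measurableSet_degree t i l)
  have hhit : ∀ l : ℕ, P.real (F l ∩ H) = P.real (F l) * (l * α) := by
    intro l
    refine hG.real_inter_step hr hrm (Finset.mem_Icc.2 ⟨hi, by omega⟩)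
      (hE.inter (DependsOnPast.of_eq (fun g : BAGraph => g.degree i) l)) (by positivity) ?_
    intro ω hω
    have hd : (G t ω).degree i = l := hω.2
    rw [attachProb, if_neg (by omega), hd, hα, mul_one_div]
    congr 1
    push_cast
    ring
  have hmiss : ∀ l : ℕ, P.real (F l \ H) = P.real (F l) * (1 - l * α) := by
    intro l
    have := measureReal_inter_add_sdiff (μ := P) (s := F l) hHm
    rw [hhit l] at this
    linarith
  have hdeg : ∀ᵐ ω ∂P, (ω ∈ H → (G (t + 1) ω).degree i = (G t ω).degree i + 1) ∧
      (ω ∉ H → (G (t + 1) ω).degree i = (G t ω).degree i) := by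
    filter_upwards [hG.ae_exists_addEdge n hr hrm] with ω ⟨j, hj, hω⟩
    constructor
    · intro h
      have h1 : G (t + 1) ω = (G t ω).addEdge (n + 1) i := h
      rw [h1, BAGraph.degree_addEdge, if_neg (by omega), if_pos rfl]
    · intro h
      have h1 : i ≠ j := by
        rintro rfl
        exact h hω
      rw [hω, BAGraph.degree_addEdge, if_neg (by omega), if_neg h1, add_zero, add_zero]
  change _ = (1 - k * α) * P.real (F k) + ((k - 1 : ℕ) : ℝ) * α * P.real (F (k - 1))
  cases k with
  | zero =>
    have : P.real (E ∩ {ω | (G (t + 1) ω).degree i = 0}) = P.real (F 0 \ H) := by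
      refine measureReal_congr ?_
      filter_upwards [hdeg] with ω ⟨h1, h2⟩
      refine propext ⟨fun h => ?_, fun h => ?_⟩
      · have h3 : (G (t + 1) ω).degree i = 0 := h.2
        by_cases h4 : ω ∈ H
        · have := h1 h4; omega
        · exact ⟨⟨h.1, (h2 h4).symm.trans h3⟩, h4⟩
      · exact ⟨h.1.1, (h2 h.2).trans h.1.2⟩
    rw [this, hmiss]
    simp
  | succ k =>
    have : P.real (E ∩ {ω | (G (t + 1) ω).degree i = k + 1}) =
        P.real (F (k + 1) \ H ∪ F k ∩ H) := by
      refine measureReal_congr ?_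
      filter_upwards [hdeg] with ω ⟨h1, h2⟩
      refine propext ⟨fun h => ?_, fun h => ?_⟩
      · have h3 : (G (t + 1) ω).degree i = k + 1 := h.2
        by_cases h4 : ω ∈ H
        · refine Or.inr ⟨⟨h.1, ?_⟩, h4⟩
          have := h1 h4
          change (G t ω).degree i = k
          omega
        · exact Or.inl ⟨⟨h.1, (h2 h4).symm.trans h3⟩, h4⟩
      · rcases h with h | h
        · exact ⟨h.1.1, (h2 h.2).trans h.1.2⟩
        · refine ⟨h.1.1, (h1 h.2).trans ?_⟩
          have h3 : (G t ω).degree i = k := h.1.2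
          rw [h3]
    rw [this, measureReal_union _ ((hFm k).inter hHm), hmiss, hhit]
    · simp only [Nat.add_sub_cancel]
      ring
    · rw [Set.disjoint_left]
      exact fun ω h1 h2 => h1.2 h2.2

/-- After its first block of edges the degree of a vertex evolves, given events of the past, as a
linear birth chain. -/
lemma real_inter_degree_succ (hG : IsBAProcess m P G) {i t : ℕ} (hi : 1 ≤ i)
    (hit : i * (m + 1) ≤ t) {E : Set Ω} (hEm : MeasurableSet E) (hE : DependsOnPast G t E)
    (k : ℕ) :
    P.real (E ∩ {ω | (G (t + 1) ω).degree i = k}) =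
      yuleStep (attachRate m t) (fun l => P.real (E ∩ {ω | (G t ω).degree i = l})) k := by
  obtain ⟨n, r, hr, rfl⟩ : ∃ n r, r ≤ m ∧ t = n * (m + 1) + r :=
    ⟨t / (m + 1), t % (m + 1), Nat.lt_succ_iff.1 (Nat.mod_lt _ (Nat.succ_pos m)),
      (Nat.div_add_mod' t (m + 1)).symm⟩
  have hin : i ≤ n := by
    by_contra! h
    have : (n + 1) * (m + 1) ≤ i * (m + 1) := Nat.mul_le_mul_right _ h
    rw [add_mul] at this
    omega
  rcases Nat.eq_zero_or_pos r with rfl | hr0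
  · rw [add_zero, attachRate_zero, yuleStep]
    simp only [mul_zero, sub_zero, one_mul, zero_mul, add_zero]
    refine measureReal_congr ?_
    filter_upwards [hG.vertex_step n] with ω hω
    refine propext (and_congr_right fun _ => ?_)
    simp only [Set.mem_ofPred_eq, hω, BAGraph.degree_addVertex]
  · rw [attachRate_add n hr0 hr]
    exact hG.real_inter_degree_edge_step hi hin hr0 hr hEm hE k

/-- The constant depends only on the two degrees, hence is uniform in the vertex and in the past
event. The recursion is exact, so only the Euler errors `α ^ 2` remain. -/
lemma exists_abs_real_inter_degree_sub_le (a k : ℕ) :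
    ∃ C : ℝ, 0 ≤ C ∧ ∀ {Ω : Type*} [MeasurableSpace Ω] {m : ℕ} {P : Measure Ω}
      [IsProbabilityMeasure P] {G : ℕ → Ω → BAGraph}, IsBAProcess m P G →
      ∀ {i s : ℕ} {E : Set Ω}, 1 ≤ i → i * (m + 1) ≤ s → MeasurableSet E → DependsOnPast G s E →
      E ⊆ {ω | (G s ω).degree i = a} → (∀ t ≥ s, 0 ≤ attachRate m t) →
      (∀ t ≥ s, k * attachRate m t ≤ 1) → ∀ J : ℕ,
      |P.real (E ∩ {ω | (G (s + J) ω).degree i = k}) -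
        P.real E * yuleProb a k (∑ j ∈ Finset.range J, attachRate m (s + j))| ≤
        C * ∑ j ∈ Finset.range J, attachRate m (s + j) ^ 2 := by
  obtain ⟨C, hC, hCl⟩ := exists_abs_sub_yuleProb_le a k
  refine ⟨C, hC, fun {Ω _ m P _ G} hG {i s E} hi his hEm hE hEa hpos hk J => ?_⟩
  have := hCl J (fun j l => P.real (E ∩ {ω | (G (s + j) ω).degree i = l}))
    (fun j => attachRate m (s + j)) (fun _ => 0) (P.real E)
    (by rw [abs_of_nonneg measureReal_nonneg]; exact measureReal_le_one) (fun l => ?_)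
    (fun j _ => hpos _ (Nat.le_add_right _ _)) (fun j _ => hk _ (Nat.le_add_right _ _))
    (fun j _ l _ => ?_)
  · simpa only [zero_add] using this
  · rw [add_zero]
    split_ifs with h
    · rw [h, Set.inter_eq_left.2 hEa]
    · rw [Set.disjoint_iff_inter_eq_empty.1, measureReal_empty]
      rw [Set.disjoint_left]
      intro ω hω hω'
      exact h (hω'.symm.trans (hEa hω))
  · rw [← add_assoc, hG.real_inter_degree_succ hi (his.trans (Nat.le_add_right _ _)) hEm
      (hE.mono (Nat.le_add_right _ _))]
    simp

end IsBAProcess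

/-! ### Asymptotics of the accumulated attachment rates. -/

lemma attachRate_mem_Icc {m n t : ℕ} (hm : 1 ≤ m) (hn : 1 ≤ n) (ht : n * (m + 1) ≤ t) :
    attachRate m t ∈ Set.Icc (0 : ℝ) (1 / (2 * n)) := by
  have hn' : (1 : ℝ) ≤ n := by exact_mod_cast hn
  unfold attachRate
  split_ifs with h
  · exact ⟨le_rfl, by positivity⟩
  · have h1 : (1 : ℝ) ≤ (t % (m + 1) : ℕ) := by exact_mod_cast Nat.one_le_iff_ne_zero.2 h
    have h2 : (n : ℝ) ≤ (t / (m + 1) : ℕ) := by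
      exact_mod_cast (Nat.le_div_iff_mul_le (Nat.succ_pos m)).2 ht
    have h3 : (1 : ℝ) ≤ m := by exact_mod_cast hm
    have h4 : (n : ℝ) ≤ m * (t / (m + 1) : ℕ) := by nlinarith
    have h5 : 2 * (n : ℝ) ≤ 2 * ((m : ℝ) * (t / (m + 1) : ℕ) + (t % (m + 1) : ℕ)) - 1 := by
      linarith
    exact ⟨one_div_nonneg.2 (by linarith), one_div_le_one_div_of_le (by linarith) h5⟩

/-- The vertex step contributes `0` and each of the `m` edges about `1 / (2 * m * n)`, so `m`
cancels and the intensity `1/2` appears. -/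
lemma sum_attachRate_block_mem_Icc {m n : ℕ} (hm : 1 ≤ m) (hn : 1 ≤ n) :
    ∑ j ∈ Finset.range (m + 1), attachRate m (n * (m + 1) + j) ∈
      Set.Icc (1 / (2 * ((n : ℝ) + 1))) (1 / (2 * (n : ℝ))) := by
  have hn' : (1 : ℝ) ≤ n := by exact_mod_cast hn
  have hm' : (1 : ℝ) ≤ m := by exact_mod_cast hm
  rw [Finset.sum_range_succ', add_zero, attachRate_zero, add_zero]
  have h : ∀ j ∈ Finset.range m, 1 / (2 * (m * ((n : ℝ) + 1))) ≤
      attachRate m (n * (m + 1) + (j + 1)) ∧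
      attachRate m (n * (m + 1) + (j + 1)) ≤ 1 / (2 * (m * (n : ℝ))) := by
    intro j hj
    have hj := Finset.mem_range.1 hj
    have hj' : (j : ℝ) + 1 ≤ m := by exact_mod_cast hj
    have hj0 : (0 : ℝ) ≤ j := by positivity
    have hmn : (0 : ℝ) < m * n := by positivity
    rw [attachRate_add n (by omega) (by omega)]
    push_cast
    exact ⟨one_div_le_one_div_of_le (by linarith) (by linarith),
      one_div_le_one_div_of_le (by positivity) (by linarith)⟩
  constructor
  · have := Finset.sum_le_sum fun j hj => (h j hj).1
    simp only [Finset.sum_const, Finset.card_range, nsmul_eq_mul] at this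
    refine le_trans (le_of_eq ?_) this
    field_simp
  · have := Finset.sum_le_sum fun j hj => (h j hj).2
    simp only [Finset.sum_const, Finset.card_range, nsmul_eq_mul] at this
    refine this.trans (le_of_eq ?_)
    field_simp

/-- The block sums are compared with telescoping logarithms through `log y ≤ y - 1`; the shifts by
`±1` disappear on the scale `i`. -/
lemma sum_attachRate_mem_Icc {m N : ℕ} (hm : 1 ≤ m) (hN : 2 ≤ N) (q : ℕ) :
    ∑ j ∈ Finset.range (q * (m + 1)), attachRate m (N * (m + 1) + j) ∈
      Set.Icc (1 / 2 * (Real.log ((N + q : ℕ) + 1) - Real.log (N + 1)))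
        (1 / 2 * (Real.log ((N + q : ℕ) - 1) - Real.log (N - 1))) := by
  induction q with
  | zero => simp
  | succ q ih =>
    have hb := sum_attachRate_block_mem_Icc hm (show 1 ≤ N + q by omega)
    rw [add_mul q, one_mul, Finset.sum_range_add]
    simp only [← add_assoc, ← add_mul]
    have hx : (2 : ℝ) ≤ (N + q : ℕ) := by exact_mod_cast (show 2 ≤ N + q by omega)
    have hx' : ((N + q + 1 : ℕ) : ℝ) = (N + q : ℕ) + 1 := by push_cast; ring
    rw [hx']
    set x : ℝ := ((N + q : ℕ) : ℝ) with hxdef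
    have h1 : Real.log (x + 1 + 1) - Real.log (x + 1) ≤ 1 / (x + 1) := by
      rw [← Real.log_div (by linarith) (by linarith)]
      refine (Real.log_le_sub_one_of_pos (by positivity)).trans (le_of_eq ?_)
      field_simp
      ring
    have h2 : 1 / x ≤ Real.log (x + 1 - 1) - Real.log (x - 1) := by
      have h3 : Real.log (x - 1) - Real.log x ≤ -(1 / x) := by
        rw [← Real.log_div (by linarith) (by linarith)]
        refine (Real.log_le_sub_one_of_pos (div_pos (by linarith) (by linarith))).trans
          (le_of_eq ?_)
        field_simp
        ring
      rw [add_sub_cancel_right]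
      linarith
    have h4 : 1 / (2 * (x + 1)) = 1 / 2 * (1 / (x + 1)) := by rw [one_div_mul_one_div]
    have h5 : 1 / (2 * x) = 1 / 2 * (1 / x) := by rw [one_div_mul_one_div]
    rw [h4, h5] at hb
    constructor
    · linarith [ih.1, hb.1]
    · linarith [ih.2, hb.2]

lemma tendsto_sum_attachRate {m : ℕ} (hm : 1 ≤ m) {N M : ℕ → ℕ} (hNM : ∀ i, N i ≤ M i)
    {ρ ρ' : ℝ} (hρ : 0 < ρ) (hρ' : 0 < ρ')
    (hN : Tendsto (fun i => (N i : ℝ) / (i : ℝ)) atTop (𝓝 ρ)) (hi : ∀ i, i ≤ N i)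
    (hM : Tendsto (fun i => (M i : ℝ) / (i : ℝ)) atTop (𝓝 ρ')) :
    Tendsto (fun i => ∑ j ∈ Finset.range ((M i - N i) * (m + 1)),
      attachRate m (N i * (m + 1) + j)) atTop (𝓝 (1 / 2 * (Real.log ρ' - Real.log ρ))) := by
  have hlog : ∀ (L : ℕ → ℕ) (σ e : ℝ), 0 < σ →
      Tendsto (fun i => (L i : ℝ) / (i : ℝ)) atTop (𝓝 σ) →
      Tendsto (fun i : ℕ => Real.log (((L i : ℝ) + e) / i)) atTop (𝓝 (Real.log σ)) := by
    intro L σ e hσ hL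
    refine Tendsto.log ?_ hσ.ne'
    have := hL.add (tendsto_const_div_atTop_nhds_zero_nat e)
    rw [add_zero] at this
    exact this.congr fun i => (add_div _ _ _).symm
  have hdiff : ∀ e : ℝ, -1 ≤ e → ∀ᶠ i in atTop,
      1 / 2 * (Real.log (((M i : ℝ) + e) / i) - Real.log (((N i : ℝ) + e) / i)) =
      1 / 2 * (Real.log ((M i : ℝ) + e) - Real.log ((N i : ℝ) + e)) := by
    intro e he
    filter_upwards [eventually_ge_atTop 2] with i h2
    have h2' : (2 : ℝ) ≤ i := by exact_mod_cast h2
    have h3 : (i : ℝ) ≤ N i := by exact_mod_cast hi i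
    have h4 : (N i : ℝ) ≤ M i := by exact_mod_cast hNM i
    rw [Real.log_div (by linarith) (by linarith), Real.log_div (by linarith) (by linarith)]
    ring
  have hlim : ∀ e : ℝ, -1 ≤ e → Tendsto (fun i =>
      1 / 2 * (Real.log ((M i : ℝ) + e) - Real.log ((N i : ℝ) + e))) atTop
      (𝓝 (1 / 2 * (Real.log ρ' - Real.log ρ))) := fun e he =>
    (((hlog M ρ' e hρ' hM).sub (hlog N ρ e hρ hN)).const_mul _).congr' (hdiff e he)
  refine tendsto_of_tendsto_of_tendsto_of_le_of_le' (hlim 1 (by norm_num)) (hlim (-1) le_rfl) ?_ ?_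
  all_goals
    filter_upwards [eventually_ge_atTop 2] with i h2
    have := sum_attachRate_mem_Icc hm (h2.trans (hi i)) (M i - N i)
    rw [show N i + (M i - N i) = M i from Nat.add_sub_cancel' (hNM i)] at this
  · exact this.1
  · exact this.2

/-- All rates involved are at most `1 / (2 * i)`, while their sum converges. -/
lemma tendsto_sum_attachRate_sq {m : ℕ} (hm : 1 ≤ m) {N J : ℕ → ℕ} {τ : ℝ} (hi : ∀ i, i ≤ N i)
    (h : Tendsto (fun i => ∑ j ∈ Finset.range (J i), attachRate m (N i * (m + 1) + j)) atTop
      (𝓝 τ)) :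
    Tendsto (fun i => ∑ j ∈ Finset.range (J i), attachRate m (N i * (m + 1) + j) ^ 2) atTop
      (𝓝 0) := by
  have h1 : Tendsto (fun i : ℕ => 1 / (2 * (i : ℝ)) *
      ∑ j ∈ Finset.range (J i), attachRate m (N i * (m + 1) + j)) atTop (𝓝 0) := by
    have h2 : Tendsto (fun i : ℕ => 1 / (2 * (i : ℝ))) atTop (𝓝 0) := by
      refine (tendsto_const_div_atTop_nhds_zero_nat (1 / 2 : ℝ)).congr fun i => ?_
      rw [div_div]
    simpa using h2.mul h
  refine squeeze_zero' (Eventually.of_forall fun i => Finset.sum_nonneg fun j _ => sq_nonneg _) ?_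
    h1
  filter_upwards [eventually_ge_atTop 1] with i hi1
  rw [Finset.mul_sum]
  refine Finset.sum_le_sum fun j _ => ?_
  have h3 := attachRate_mem_Icc (t := N i * (m + 1) + j) hm hi1
    ((Nat.mul_le_mul_right _ (hi i)).trans (Nat.le_add_right _ _))
  rw [sq]
  exact mul_le_mul_of_nonneg_right h3.2 h3.1

lemma continuous_yuleProb (a k : ℕ) : Continuous (yuleProb a k) :=
  continuous_iff_continuousAt.2 fun t => (hasDerivAt_yuleProb a k t).continuousAt

/-! ### Limits of the joint degree probabilities at ordered times. -/

namespace IsBAProcess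

variable {Ω : Type*} [MeasurableSpace Ω] {m : ℕ} {P : Measure Ω} {G : ℕ → Ω → BAGraph}

lemma measurableSet_forall_degree (hG : IsBAProcess m P G) {b : ℕ} (i : ℕ) (t k : Fin b → ℕ) :
    MeasurableSet {ω | ∀ l, (G (t l) ω).degree i = k l} := by
  have : {ω | ∀ l, (G (t l) ω).degree i = k l} = ⋂ l, {ω | (G (t l) ω).degree i = k l} := by
    ext; simp
  rw [this]
  exact MeasurableSet.iInter fun l => hG.measurableSet_degree _ _ _

variable [IsProbabilityMeasure P]

/-- Induction on the number of times: the event at all earlier times is an event of the past that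
fixes the current degree, so one more transition multiplies the limit by one factor `yuleProb`. -/
lemma tendsto_real_forall_degree_of_init (hG : IsBAProcess m P G) (hm : 1 ≤ m) (b : ℕ)
    (N : Fin (b + 1) → ℕ → ℕ) (hiN : ∀ i, i ≤ N 0 i) (hN : Monotone N) (ρ : Fin (b + 1) → ℝ)
    (hρ : ∀ l, 0 < ρ l)
    (hNρ : ∀ l, Tendsto (fun i => (N l i : ℝ) / (i : ℝ)) atTop (𝓝 (ρ l))) (k : Fin (b + 1) → ℕ)
    {p : ℝ} (hp : Tendsto (fun i => P.real {ω | (G (N 0 i * (m + 1)) ω).degree i = k 0}) atTop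
      (𝓝 p)) :
    Tendsto (fun i => P.real {ω | ∀ l, (G (N l i * (m + 1)) ω).degree i = k l}) atTop
      (𝓝 (p * ∏ l : Fin b, yuleProb (k l.castSucc) (k l.succ)
        (1 / 2 * (Real.log (ρ l.succ) - Real.log (ρ l.castSucc))))) := by
  induction b with
  | zero => simpa [Fin.forall_fin_one] using hp
  | succ b ih =>
    have h1 := ih (fun l => N l.castSucc) hiN
      (fun _ _ h => hN (Fin.castSucc_le_castSucc_iff.2 h)) (fun l => ρ l.castSucc)
      (fun l => hρ _) (fun l => hNρ _) (fun l => k l.castSucc) hp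
    set S : ℕ → ℕ := N (Fin.last b).castSucc with hS
    set M : ℕ → ℕ := N (Fin.last (b + 1)) with hM
    have hSM : ∀ i, S i ≤ M i := fun i => hN (Fin.le_last _) i
    have hiS : ∀ i, i ≤ S i := fun i => (hiN i).trans (hN (Fin.zero_le _) i)
    set E : ℕ → Set Ω := fun i =>
      {ω | ∀ l : Fin (b + 1), (G (N l.castSucc i * (m + 1)) ω).degree i = k l.castSucc} with hE
    have hτ := tendsto_sum_attachRate hm hSM (hρ _) (hρ _) (hNρ _) hiS (hNρ _)
    have hsq := tendsto_sum_attachRate_sq hm hiS hτ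
    obtain ⟨C, hC, hCl⟩ := exists_abs_real_inter_degree_sub_le
      (k (Fin.last b).castSucc) (k (Fin.last (b + 1)))
    have hset : ∀ i, {ω | ∀ l, (G (N l i * (m + 1)) ω).degree i = k l} =
        E i ∩ {ω | (G (S i * (m + 1) + (M i - S i) * (m + 1)) ω).degree i =
          k (Fin.last (b + 1))} := by
      intro i
      rw [← add_mul, Nat.add_sub_cancel' (hSM i)]
      ext ω
      simp [hE, hM, Fin.forall_fin_succ']
    have hlim := h1.mul (((continuous_yuleProb (k (Fin.last b).castSucc)
      (k (Fin.last (b + 1)))).tendsto _).comp hτ)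
    have hdiff : Tendsto (fun i => P.real {ω | ∀ l, (G (N l i * (m + 1)) ω).degree i = k l} -
        P.real (E i) * yuleProb (k (Fin.last b).castSucc) (k (Fin.last (b + 1)))
          (∑ j ∈ Finset.range ((M i - S i) * (m + 1)), attachRate m (S i * (m + 1) + j)))
        atTop (𝓝 0) := by
      have hsq' := hsq.const_mul C
      rw [mul_zero] at hsq'
      refine squeeze_zero_norm' ?_ hsq'
      filter_upwards [eventually_ge_atTop 1, eventually_ge_atTop (k (Fin.last (b + 1)))]
        with i hi1 hik
      have hrate : ∀ t ≥ S i * (m + 1), attachRate m t ∈ Set.Icc (0 : ℝ) (1 / (2 * i)) :=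
        fun t ht => attachRate_mem_Icc hm hi1 ((Nat.mul_le_mul_right _ (hiS i)).trans ht)
      rw [hset]
      refine hCl hG (E := E i) hi1 (Nat.mul_le_mul_right _ (hiS i))
        (hG.measurableSet_forall_degree i _ _) ?_ (fun ω hω => hω (Fin.last b))
        (fun t ht => (hrate t ht).1) (fun t ht => ?_) _
      · intro ω ω' h hω l
        rw [← h (N l.castSucc i * (m + 1)) (Nat.mul_le_mul_right _
          (hN (Fin.castSucc_le_castSucc_iff.2 (Fin.le_last l)) i))]
        exact hω l
      · have hi0 : (0 : ℝ) < i := by exact_mod_cast hi1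
        have hik' : (k (Fin.last (b + 1)) : ℝ) ≤ i := by exact_mod_cast hik
        calc _ ≤ (i : ℝ) * (1 / (2 * i)) :=
              mul_le_mul hik' (hrate t ht).2 (hrate t ht).1 hi0.le
          _ ≤ 1 := by
              rw [mul_one_div, div_le_one (by positivity)]
              linarith
    have := hdiff.add hlim
    rw [zero_add] at this
    rw [Fin.prod_univ_castSucc, ← mul_assoc]
    refine this.congr fun i => ?_
    simp [hE]

/-- A vertex most likely has no loops, so that its degree is `m` after its first block of edges. -/
lemma tendsto_real_degree_birth (hG : IsBAProcess m P G) (hm : 1 ≤ m) :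
    Tendsto (fun i => P.real {ω | (G (i * (m + 1)) ω).degree i = m}) atTop (𝓝 1) := by
  have key : ∀ r ≤ m, Tendsto (fun n =>
      P.real {ω | (G (n * (m + 1) + (r + 1)) ω).degree (n + 1) = r}) atTop (𝓝 1) := by
    intro r
    induction r with
    | zero =>
      intro _
      refine tendsto_const_nhds.congr fun n => ?_
      have h : {ω | (G (n * (m + 1) + (0 + 1)) ω).degree (n + 1) = 0} =ᵐ[P] Set.univ := by
        refine eventuallyEq_univ.2 ?_
        filter_upwards [(hG.ae_hasSize n).1, hG.vertex_step n] with ω h1 h2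
        simp only [zero_add, h2, BAGraph.degree_addVertex]
        exact h1.degree_eq_zero (Nat.lt_succ_self n)
      rw [measureReal_congr h, probReal_univ]
    | succ r ih =>
      intro hr
      have h1 := ih (by omega)
      set c : ℕ → ℝ := fun n => ((r : ℝ) + 1) / (2 * ((m : ℝ) * n + r) + 1) with hc
      have hc0 : Tendsto c atTop (𝓝 0) := by
        refine tendsto_const_nhds.div_atTop
          (tendsto_atTop_mono (fun n => ?_) (tendsto_natCast_atTop_atTop (R := ℝ)))
        have h1 : (1 : ℝ) ≤ m := by exact_mod_cast hm
        have h2 : (0 : ℝ) ≤ n := n.cast_nonneg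
        have h3 : (0 : ℝ) ≤ r := r.cast_nonneg
        nlinarith
      -- Here `c n` is the probability that the next edge is a loop when `v_{n+1}` has degree `r`;
      -- any other endpoint raises its degree by exactly one.
      have hstep : ∀ n, P.real {ω | (G (n * (m + 1) + (r + 1)) ω).degree (n + 1) = r} *
          (1 - c n) ≤
          P.real {ω | (G (n * (m + 1) + (r + 1 + 1)) ω).degree (n + 1) = r + 1} := by
        intro n
        set t := n * (m + 1) + (r + 1) with ht
        set E : Set Ω := {ω | (G t ω).degree (n + 1) = r} with hE
        set H : Set Ω := {ω | G (t + 1) ω = (G t ω).addEdge (n + 1) (n + 1)} with hH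
        have hHm : MeasurableSet H := hG.measurableSet_step t fun g => g.addEdge (n + 1) (n + 1)
        have h2 : P.real (E ∩ H) = P.real E * c n := by
          refine hG.real_inter_step (by omega) hr (by simp)
            (DependsOnPast.of_eq (fun g : BAGraph => g.degree (n + 1)) r)
            (by positivity) fun ω hω => ?_
          have hd : (G (n * (m + 1) + (r + 1)) ω).degree (n + 1) = r := hω
          rw [attachProb, if_pos rfl, hd, hc]
          congr 1
          push_cast
          ring
        have h3 := measureReal_inter_add_sdiff (μ := P) (s := E) hHm
        have h4 : P.real (E \ H) ≤ P.real {ω | (G (t + 1) ω).degree (n + 1) = r + 1} := by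
          refine ENNReal.toReal_mono (measure_ne_top _ _) (measure_mono_ae ?_)
          filter_upwards [hG.ae_exists_addEdge n (show 1 ≤ r + 1 by omega) hr]
            with ω ⟨j, hj, hω⟩ hωE
          have h5 : n + 1 ≠ j := by
            rintro rfl
            exact hωE.2 hω
          have hd : (G (n * (m + 1) + (r + 1)) ω).degree (n + 1) = r := hωE.1
          change (G (t + 1) ω).degree (n + 1) = r + 1
          rw [hω, BAGraph.degree_addEdge, if_pos rfl, if_neg h5, hd]
        change _ ≤ P.real {ω | (G (t + 1) ω).degree (n + 1) = r + 1}
        linarith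
      have hlow := h1.mul (hc0.const_sub 1)
      rw [sub_zero, mul_one] at hlow
      exact tendsto_of_tendsto_of_tendsto_of_le_of_le hlow tendsto_const_nhds hstep
        fun n => measureReal_le_one
  -- With `i = n + 1`, time `i * (m + 1)` is the end of the block in which `v_i` is born.
  rw [← tendsto_add_atTop_iff_nat 1]
  refine (key m le_rfl).congr fun n => ?_
  rw [add_mul n, one_mul]

lemma tendsto_real_forall_degree (hG : IsBAProcess m P G) (hm : 1 ≤ m) {b : ℕ}
    (N : Fin b → ℕ → ℕ) (hiN : ∀ l i, i ≤ N l i) (hN : Monotone N) (ρ : Fin b → ℝ)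
    (hNρ : ∀ l, Tendsto (fun i => (N l i : ℝ) / (i : ℝ)) atTop (𝓝 (ρ l))) (k : Fin b → ℕ) :
    Tendsto (fun i => P.real {ω | ∀ l, (G (N l i * (m + 1)) ω).degree i = k l}) atTop
      (𝓝 (∏ l : Fin b, yuleProb ((Fin.cons m k : Fin (b + 1) → ℕ) l.castSucc) (k l)
        (1 / 2 * (Real.log (ρ l) -
          Real.log ((Fin.cons 1 ρ : Fin (b + 1) → ℝ) l.castSucc))))) := by
  have hid : Tendsto (fun i : ℕ => (i : ℝ) / (i : ℝ)) atTop (𝓝 1) := by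
    refine tendsto_const_nhds.congr' ?_
    filter_upwards [eventually_gt_atTop 0] with i hi
    rw [div_self]
    exact_mod_cast hi.ne'
  have hρ : ∀ l, 1 ≤ ρ l := fun l => le_of_tendsto_of_tendsto' hid (hNρ l) fun i => by
    gcongr
    exact hiN l i
  have hbirth := hG.tendsto_real_degree_birth hm
  have h1 := hG.tendsto_real_forall_degree_of_init hm b (Fin.cons (fun i => i) N)
    (fun i => le_rfl) (monotone_finCons (fun l i => hiN l i) hN) (Fin.cons 1 ρ)
    (fun l => by
      cases l using Fin.cases with
      | zero => exact one_pos
      | succ l => exact one_pos.trans_le (hρ l))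
    (fun l => by
      cases l using Fin.cases with
      | zero => exact hid
      | succ l => exact hNρ l) (Fin.cons m k) hbirth
  simp only [one_mul, Fin.cons_succ] at h1
  -- Adding the constraint that the degree is `m` at the end of the birth block costs at most the
  -- probability that it fails, which tends to `0`.
  have h2 : Tendsto (fun i => P.real {ω | ∀ l, (G (N l i * (m + 1)) ω).degree i = k l} -
      P.real {ω | ∀ l : Fin (b + 1), (G ((Fin.cons (fun i => i) N : Fin (b + 1) → ℕ → ℕ) l i *
        (m + 1)) ω).degree i = (Fin.cons m k : Fin (b + 1) → ℕ) l}) atTop (𝓝 0) := by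
    have h3 := hbirth.const_sub 1
    rw [sub_self] at h3
    refine squeeze_zero (fun i => ?_) (fun i => ?_) h3
    · refine sub_nonneg.2 (measureReal_mono fun ω hω => ?_)
      exact fun l => hω l.succ
    · have hm' := hG.measurableSet_degree (i * (m + 1)) i m
      have h4 := measureReal_inter_add_sdiff (μ := P)
        (s := {ω | ∀ l, (G (N l i * (m + 1)) ω).degree i = k l}) hm'
      have h5 : {ω | ∀ l : Fin (b + 1),
          (G ((Fin.cons (fun i => i) N : Fin (b + 1) → ℕ → ℕ) l i *
            (m + 1)) ω).degree i = (Fin.cons m k : Fin (b + 1) → ℕ) l} =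
          {ω | ∀ l, (G (N l i * (m + 1)) ω).degree i = k l} ∩
            {ω | (G (i * (m + 1)) ω).degree i = m} := by
        ext ω
        simp [Fin.forall_fin_succ, and_comm]
      have h6 : P.real ({ω | ∀ l, (G (N l i * (m + 1)) ω).degree i = k l} \
          {ω | (G (i * (m + 1)) ω).degree i = m}) ≤
          P.real {ω | (G (i * (m + 1)) ω).degree i = m}ᶜ :=
        measureReal_mono fun ω hω => hω.2
      rw [probReal_compl_eq_one_sub hm'] at h6
      rw [h5]
      linarith
  have h7 := h2.add h1
  rw [zero_add] at h7
  exact h7.congr fun i => by ring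

end IsBAProcess

/-! ### The product formula, and times that are ordered only in the limit. -/

lemma yuleProduct_eq_prod_yuleProb (m : ℕ) {b : ℕ} (k : Fin b → ℕ) (hk : ∀ l, m ≤ k l)
    (hk' : Monotone k) (c : Fin b → ℝ) (hc : ∀ l, 0 ≤ c l) :
    yuleProduct m k c = ∏ l : Fin b, yuleProb ((Fin.cons m k : Fin (b + 1) → ℕ) l.castSucc) (k l)
      (1 / 2 * (Real.log (1 + c l) -
        Real.log ((Fin.cons 1 (fun l => 1 + c l) : Fin (b + 1) → ℝ) l.castSucc))) := by
  refine Finset.prod_congr rfl fun l _ => ?_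
  have hC : (Fin.cons 1 (fun l => 1 + c l) : Fin (b + 1) → ℝ) l.castSucc =
      1 + (Fin.cons 0 c : Fin (b + 1) → ℝ) l.castSucc := by
    generalize l.castSucc = j
    cases j using Fin.cases <;> simp
  have hC0 : 0 ≤ (Fin.cons 0 c : Fin (b + 1) → ℝ) l.castSucc := by
    generalize l.castSucc = j
    cases j using Fin.cases <;> simp [hc]
  have hK := monotone_finCons hk hk' (Fin.castSucc_lt_succ (i := l)).le
  simp only [Fin.cons_succ] at hK ⊢
  rw [yuleProb, if_neg hK.not_gt, hC, Real.log_div (by linarith [hc l]) (by linarith)]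
  congr 3
  · ring_nf
  · ring_nf

lemma tendsto_sup_div_natCast {ι : Type*} (s : Finset ι) (z : ℕ → ι → ℕ) (c : ι → ℝ) {j : ι}
    (hj : j ∈ s) (hc : ∀ l ∈ s, c l ≤ c j)
    (hz : ∀ l ∈ s, Tendsto (fun i : ℕ => (z i l : ℝ) / (i : ℝ)) atTop (𝓝 (c l))) :
    Tendsto (fun i : ℕ => ((s.sup (z i) : ℕ) : ℝ) / (i : ℝ)) atTop (𝓝 (c j)) := by
  refine tendsto_order.2 ⟨fun a ha => ?_, fun a ha => ?_⟩
  · filter_upwards [(tendsto_order.1 (hz j hj)).1 a ha] with i hi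
    refine hi.trans_le ?_
    gcongr
    exact Finset.le_sup hj
  · have : ∀ᶠ i : ℕ in atTop, ∀ l ∈ s, (z i l : ℝ) / (i : ℝ) < a :=
      (Filter.eventually_all_finset s).2 fun l hl =>
        (tendsto_order.1 (hz l hl)).2 a ((hc l hl).trans_lt ha)
    filter_upwards [this] with i hi
    obtain ⟨l, hl, hle⟩ := s.exists_mem_eq_sup ⟨j, hj⟩ (z i)
    rw [hle]
    exact hi l hl

lemma tendsto_measureReal_symmDiff {Ω : Type*} [MeasurableSpace Ω] {P : Measure Ω}
    [IsFiniteMeasure P] {A B : ℕ → Set Ω} {q : ℝ} (hA : ∀ i, MeasurableSet (A i))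
    (hB : ∀ i, MeasurableSet (B i)) (hAq : Tendsto (fun i => P.real (A i)) atTop (𝓝 q))
    (hBq : Tendsto (fun i => P.real (B i)) atTop (𝓝 q))
    (hABq : Tendsto (fun i => P.real (A i ∩ B i)) atTop (𝓝 q)) :
    Tendsto (fun i => P.real (symmDiff (A i) (B i))) atTop (𝓝 0) := by
  have h := (hAq.sub hABq).add (hBq.sub hABq)
  simp only [sub_self, add_zero] at h
  refine h.congr fun i => ?_
  rw [measureReal_symmDiff_eq (hA i) (hB i)]
  have h1 := measureReal_inter_add_sdiff (μ := P) (s := A i) (hB i)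
  have h2 := measureReal_inter_add_sdiff (μ := P) (s := B i) (hA i)
  rw [Set.inter_comm] at h2
  linarith

namespace IsBAProcess

variable {Ω : Type*} [MeasurableSpace Ω] {m : ℕ} {P : Measure Ω} {G : ℕ → Ω → BAGraph}
  [IsProbabilityMeasure P]

lemma tendsto_real_degree (hG : IsBAProcess m P G) (hm : 1 ≤ m) {N : ℕ → ℕ} (hiN : ∀ i, i ≤ N i)
    {ρ : ℝ} (hNρ : Tendsto (fun i => (N i : ℝ) / (i : ℝ)) atTop (𝓝 ρ)) (k : ℕ) :
    Tendsto (fun i => P.real {ω | (G (N i * (m + 1)) ω).degree i = k}) atTop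
      (𝓝 (yuleProb m k (1 / 2 * (Real.log ρ - Real.log 1)))) := by
  have := hG.tendsto_real_forall_degree hm (fun _ : Fin 1 => N) (fun _ => hiN) monotone_const
    (fun _ => ρ) (fun _ => hNρ) (fun _ => k)
  simpa using this

/-- The degree of `v_i` most likely does not change in a time interval that is short compared
to `i`. -/
lemma tendsto_real_symmDiff_degree (hG : IsBAProcess m P G) (hm : 1 ≤ m) {N M : ℕ → ℕ}
    (hiN : ∀ i, i ≤ N i) (hNM : N ≤ M) {ρ : ℝ}
    (hNρ : Tendsto (fun i => (N i : ℝ) / (i : ℝ)) atTop (𝓝 ρ))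
    (hMρ : Tendsto (fun i => (M i : ℝ) / (i : ℝ)) atTop (𝓝 ρ)) (k : ℕ) :
    Tendsto (fun i => P.real (symmDiff {ω | (G (N i * (m + 1)) ω).degree i = k}
      {ω | (G (M i * (m + 1)) ω).degree i = k})) atTop (𝓝 0) := by
  have hiM : ∀ i, i ≤ M i := fun i => (hiN i).trans (hNM i)
  refine tendsto_measureReal_symmDiff (fun i => hG.measurableSet_degree _ _ _)
    (fun i => hG.measurableSet_degree _ _ _) (hG.tendsto_real_degree hm hiN hNρ k)
    (hG.tendsto_real_degree hm hiM hMρ k) ?_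
  have := hG.tendsto_real_forall_degree hm ![N, M]
    (by simpa [Fin.forall_fin_two] using ⟨hiN, hiM⟩)
    (by
      rw [Fin.monotone_iff_le_succ]
      intro l
      rw [Subsingleton.elim l 0]
      exact hNM)
    ![ρ, ρ] (by simpa [Fin.forall_fin_two] using ⟨hNρ, hMρ⟩) ![k, k]
  rw [Fin.prod_univ_two] at this
  simp only [Fin.forall_fin_two] at this
  -- Equal limits `ρ` mean that no Yule time elapses, so the joint probability has the same limit as
  -- each marginal.
  have h0 : yuleProb k k (1 / 2 * (Real.log ρ - Real.log ρ)) = 1 := by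
    rw [sub_self, mul_zero, yuleProb_zero, if_pos rfl]
  have h1 : yuleProb m k (1 / 2 * (Real.log ρ - Real.log 1)) *
      yuleProb k k (1 / 2 * (Real.log ρ - Real.log ρ)) =
      yuleProb m k (1 / 2 * (Real.log ρ - Real.log 1)) := by rw [h0, mul_one]
  rw [← h1]
  exact this

/-- The joint law of the degrees of `v_i` at times that are asymptotically, but perhaps not
actually, ordered. -/
lemma tendsto_real_forall_degree_add (hG : IsBAProcess m P G) (hm : 1 ≤ m) {b : ℕ}
    (z : ℕ → Fin b → ℕ) (c : Fin b → ℝ) (hc : Monotone c)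
    (hz : ∀ l, Tendsto (fun i : ℕ => (z i l : ℝ) / (i : ℝ)) atTop (𝓝 (c l))) (k : Fin b → ℕ) :
    Tendsto (fun i => P.real {ω | ∀ l, (G ((i + z i l) * (m + 1)) ω).degree i = k l}) atTop
      (𝓝 (∏ l : Fin b, yuleProb ((Fin.cons m k : Fin (b + 1) → ℕ) l.castSucc) (k l)
        (1 / 2 * (Real.log (1 + c l) -
          Real.log ((Fin.cons 1 (fun l => 1 + c l) : Fin (b + 1) → ℝ) l.castSucc))))) := by
  -- Running maxima are monotone in `l` for every `i`, and since `c` is monotone they keep the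
  -- limits `c l`.
  set Z : Fin b → ℕ → ℕ := fun l i => (Finset.univ.filter (· ≤ l)).sup (z i) with hZ
  have hZmono : Monotone Z := fun l l' hll' i => Finset.sup_mono fun j hj => by
    simp only [Finset.mem_filter, Finset.mem_univ, true_and] at hj ⊢
    exact hj.trans hll'
  have hzZ : ∀ l i, z i l ≤ Z l i := fun l i => Finset.le_sup (f := z i) (by simp)
  have hadd : ∀ {y : ℕ → ℕ} {x : ℝ}, Tendsto (fun i : ℕ => (y i : ℝ) / (i : ℝ)) atTop (𝓝 x) →
      Tendsto (fun i : ℕ => ((i + y i : ℕ) : ℝ) / (i : ℝ)) atTop (𝓝 (1 + x)) := by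
    intro y x h
    refine (h.const_add 1).congr' ?_
    filter_upwards [eventually_gt_atTop 0] with i hi
    have hi' : (i : ℝ) ≠ 0 := by exact_mod_cast hi.ne'
    push_cast
    field_simp
  have hZlim : ∀ l, Tendsto (fun i : ℕ => (Z l i : ℝ) / (i : ℝ)) atTop (𝓝 (c l)) := fun l =>
    tendsto_sup_div_natCast _ z c (by simp)
      (fun j hj => hc (by simpa using hj)) fun j _ => hz j
  have h1 := hG.tendsto_real_forall_degree hm (fun l i => i + Z l i)
    (fun l i => Nat.le_add_right _ _) (fun l l' h i => Nat.add_le_add_left (hZmono h i) i)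
    (fun l => 1 + c l) (fun l => hadd (hZlim l)) k
  have h2 := tendsto_finsetSum Finset.univ fun (l : Fin b) _ =>
    hG.tendsto_real_symmDiff_degree hm (N := fun i => i + z i l) (M := fun i => i + Z l i)
    (fun i => Nat.le_add_right _ _) (fun i => Nat.add_le_add_left (hzZ l i) i) (hadd (hz l))
    (hadd (hZlim l)) (k l)
  rw [Finset.sum_const_zero] at h2
  have h3 : Tendsto (fun i => P.real {ω | ∀ l, (G ((i + z i l) * (m + 1)) ω).degree i = k l} -
      P.real {ω | ∀ l, (G ((i + Z l i) * (m + 1)) ω).degree i = k l}) atTop (𝓝 0) := by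
    refine squeeze_zero_norm (fun i => ?_) h2
    refine (abs_measureReal_sub_le_measureReal_symmDiff
      (hG.measurableSet_forall_degree i (fun l => (i + z i l) * (m + 1)) k).nullMeasurableSet
      (hG.measurableSet_forall_degree i (fun l => (i + Z l i) * (m + 1)) k).nullMeasurableSet).trans
      ?_
    refine le_trans (measureReal_mono ?_) (measureReal_iUnion_fintype_le _)
    intro ω hω
    by_contra hcon
    rw [Set.mem_iUnion, not_exists] at hcon
    have h4 : ∀ l, (G ((i + z i l) * (m + 1)) ω).degree i = k l ↔
        (G ((i + Z l i) * (m + 1)) ω).degree i = k l := by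
      intro l
      have := hcon l
      rw [Set.mem_symmDiff] at this
      simp only [Set.mem_ofPred_eq] at this
      tauto
    rw [Set.mem_symmDiff] at hω
    simp only [Set.mem_ofPred_eq, h4] at hω
    tauto
  have h5 := h3.add h1
  rw [zero_add] at h5
  exact h5.congr fun i => by ring

end IsBAProcess

theorem theorem1 {Ω : Type*} [MeasurableSpace Ω] (P : Measure Ω) [IsProbabilityMeasure P]
    (m : ℕ) (hm : 1 ≤ m) (G : ℕ → Ω → BAGraph) (hG : IsBAProcess m P G)
    (z : ℕ → ℝ → ℕ) (c : ℝ → ℝ)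
    (hz : ∀ w : ℝ, 0 < w → Tendsto (fun i : ℕ => (z i w : ℝ) / (i : ℝ)) atTop (𝓝 (c w)))
    (hc : MonotoneOn c (Set.Ioi 0))
    (b : ℕ) (hb : 1 ≤ b) (w : Fin b → ℝ) (hw : ∀ l, 0 < w l) (hw' : StrictMono w) :
    -- the limit of the joint probabilities is given by the product formula
    (∀ k : Fin b → ℕ, (∀ l, m ≤ k l) → Monotone k →
      Tendsto (fun i : ℕ =>
          P.real {ω | ∀ l, (G ((i + z i (w l)) * (m + 1)) ω).degree i = k l})
        atTop (𝓝 (yuleProduct m k (fun l => c (w l))))) ∧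
    -- the limit law is that of the Yule process, whose joint probabilities are those products
    ∀ (Ω' : Type*) [MeasurableSpace Ω'] (Q : Measure Ω') [IsProbabilityMeasure Q]
      (N : ℝ → Ω' → ℕ), IsYuleProcess (1 / 2) m Q N →
      (∀ k : Fin b → ℕ,
        Tendsto (fun i : ℕ =>
            P.real {ω | ∀ l, (G ((i + z i (w l)) * (m + 1)) ω).degree i = k l})
          atTop (𝓝 (Q.real {ω | ∀ l, N (Real.log (1 + c (w l))) ω = k l}))) ∧
      ∀ k : Fin b → ℕ, (∀ l, m ≤ k l) → Monotone k →
        Q.real {ω | ∀ l, N (Real.log (1 + c (w l))) ω = k l} =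
          yuleProduct m k (fun l => c (w l)) := by

  -- Nonnegativity of `c` follows from that of the ratios `z i w / i`.
  have hc0 : ∀ l, 0 ≤ c (w l) := fun l => ge_of_tendsto' (hz _ (hw l)) fun i => by positivity
  have hcw : Monotone fun l => c (w l) := fun l l' h => hc (hw l) (hw l') (hw'.monotone h)
  have hlim := hG.tendsto_real_forall_degree_add hm (fun i l => z i (w l)) (fun l => c (w l)) hcw
    fun l => hz _ (hw l)
  have hprod := fun (k : Fin b → ℕ) (hk : ∀ l, m ≤ k l) (hk' : Monotone k) =>
    yuleProduct_eq_prod_yuleProb m k hk hk' (fun l => c (w l)) hc0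
  refine ⟨fun k hk hk' => ?_, fun Ω' _ Q _ N hN => ?_⟩
  · rw [hprod k hk hk']
    exact hlim k
  · have hyule : ∀ k : Fin b → ℕ, Q.real {ω | ∀ l, N (Real.log (1 + c (w l))) ω = k l} =
        ∏ l : Fin b, yuleProb ((Fin.cons m k : Fin (b + 1) → ℕ) l.castSucc) (k l)
          (1 / 2 * (Real.log (1 + c (w l)) -
            Real.log ((Fin.cons 1 (fun l => 1 + c (w l)) : Fin (b + 1) → ℝ) l.castSucc))) := by
      intro k
      rw [hN.real_forall_eq_prod_cons (by norm_num) (fun l => Real.log (1 + c (w l)))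
        (fun l => Real.log_nonneg (by linarith [hc0 l]))
        (fun l l' h => Real.log_le_log (by linarith [hc0 l]) (by linarith [hcw h]))]
      refine Finset.prod_congr rfl fun l _ => ?_
      congr 3
      generalize l.castSucc = j
      cases j using Fin.cases <;> simp
    refine ⟨fun k => ?_, fun k hk hk' => ?_⟩
    · rw [hyule k]
      exact hlim k
    · rw [hyule k, hprod k hk hk']
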